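/- Let $\mathbb K$ be an algebraically closed field of characteristic $0$, let $\mathfrak{sl}(2)$ have the basis $e,f,h$ with $[h,e]=2e$, $[h,f]=-2f$, $[e,f]=h$, and let $\lambda\in\mathbb K\setminus\{0\}$. Let $\alpha$ be the automorphism of $\mathfrak{sl}(2)$ with $\alpha(e)=\lambda e$, $\alpha(f)=\lambda^{-1}f$, $\alpha(h)=h$. The (diagonally twisted) Hom-$\mathfrak{sl}(2)$ is $\mathfrak{sl}(2)$ with the bracket $[x,y]_\alpha=\alpha([x,y])$ and the twisting map $\alpha$. A Hom-$\mathfrak{sl}(2)$-module is a vector space $V$ with $\beta\in\mathrm{End}(V)$ and a linear map $\rho_\beta:\mathfrak{sl}(2)\to\mathrm{End}(V)$, written $x.v=\rho_\beta(x)v$, such that for all $x,y$ $$\rho_\beta(\alpha(x))\,\beta=\beta\,\rho_\beta(x),\qquad \rho_\beta([x,y]_\alpha)\,\beta=\rho_\beta(\alpha(x))\rho_\beta(y)-\rho_\beta(\alpha(y))\rho_\beta(x).$$ It is irreducible if it has precisely two subspaces ($0$ and $V$) invariant under $\beta$ and all $\rho_\beta(x)$. It is a weight module if $\beta$ is invertible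 and $V$ is the direct sum of the eigenspaces (weight spaces) of $\rho(h)$, where $\rho=\beta^{-1}\circ\rho_\beta$ is the induced representation of the Lie algebra $\mathfrak{sl}(2)$. A lowest (highest) weight vector is a nonzero weight vector killed by $f$ (by $e$). Theorem. There are precisely four types of irreducible Hom-$\mathfrak{sl}(2)$ weight modules: a Hom-$\mathfrak{sl}(2)$-module is an irreducible weight module if and only if, for some $b_0\in\mathbb K\setminus\{0\}$, it has one of the following forms. 1. (Finite-dimensional.) For some integer $n\ge 0$ there is a basis $v_0,\dots,v_n$ with $\beta(v_i)=\lambda^{i}b_0v_i$ and $h.v_i=(2i-n)\lambda^{i}b_0v_i$ for $0\le i\le n$; $e.v_i=\lambda^{i+1}b_0v_{i+1}$ for $0\le i<n$, $e.v_n=0$; $f.v_i=i\lambda^{i-1}b_0(n+1-i)v_{i-1}$ for $0<i\le n$, $f.v_0=0$. 2. (Infinite-dimensional, lowest weight.) For some $\tau\in\mathbb K\setminus\{0,-1,-2,\dots\}$ there is a basis $v_0,v_1,\dots$ with $\beta(v_i)=\lambda^{i}b_0v_i$ and $h.v_i=\lambda^{i}b_0(\tau+2i)v_i$ and $e.v_i=\lambda^{i+1}b_0v_{i+1}$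 for $i\ge0$; $f.v_i=-i\lambda^{i-1}b_0(\tau+i-1)v_{i-1}$ for $i>0$, $f.v_0=0$. 3. (Infinite-dimensional, highest weight.) For some $\tau\in\mathbb K\setminus\{0,1,2,\dots\}$ there is a basis $v_0,v_1,\dots$ with $\beta(v_i)=\lambda^{-i}b_0v_i$ and $h.v_i=\lambda^{-i}b_0(\tau-2i)v_i$ and $f.v_i=\lambda^{-i-1}b_0v_{i+1}$ for $i\ge0$; $e.v_i=i\lambda^{-i+1}b_0(\tau-i+1)v_{i-1}$ for $i>0$, $e.v_0=0$. 4. (Intermediate series.) For some $\tau,\mu\in\mathbb K$ with $(\tau+2i+1)^2\ne\mu+1$ for all $i\in\mathbb Z$ there is a basis $(v_i)_{i\in\mathbb Z}$ with $\beta(v_i)=\lambda^{i}b_0v_i$ and $h.v_i=\lambda^{i}b_0(\tau+2i)v_i$ for $i\in\mathbb Z$; $e.v_i=\lambda^{i+1}b_0v_{i+1}$ for $i\ge0$, $f.v_i=\lambda^{i-1}b_0v_{i-1}$ for $i\le0$; $e.v_i=\tfrac14\big(\mu-(\tau+2i+1)^2+1\big)\lambda^{i+1}b_0v_{i+1}$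 for $i<0$; $f.v_i=\tfrac14\big(\mu-(\tau+2i-1)^2+1\big)\lambda^{i-1}b_0v_{i-1}$ for $i>0$. No module has two of these four types. For all parameters admitted above the formulas define a Hom-$\mathfrak{sl}(2)$-module. Among the irreducible weight modules, type 1 consists of the finite-dimensional ones, type 2 of the infinite-dimensional ones with a lowest weight vector, type 3 of the infinite-dimensional ones with a highest weight vector, and type 4 of the infinite-dimensional ones with neither. -/

import Mathlib

namespace HomLie

/-- A Hom-Lie algebra structure on the vector space `g`: a skew-symmetric bilinear bracket and a
linear twisting map that satisfy the Hom-Jacobi identity. -/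
structure HomLieAlgebra (K g : Type*) [Field K] [AddCommGroup g] [Module K g] where
  bracket : g →ₗ[K] g →ₗ[K] g
  twist : g →ₗ[K] g
  skew : ∀ x y, bracket x y = -bracket y x
  hom_jacobi : ∀ x y z,
    bracket (twist x) (bracket y z) + bracket (twist y) (bracket z x)
      + bracket (twist z) (bracket x y) = 0

/-- The twisting map is a morphism for the bracket. -/
def HomLieAlgebra.IsMultiplicative {K g : Type*} [Field K] [AddCommGroup g] [Module K g]
    (H : HomLieAlgebra K g) : Prop :=
  ∀ x y, H.twist (H.bracket x y) = H.bracket (H.twist x) (H.twist y)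

/-- The Yau twist of a Lie algebra along an endomorphism `α`: the bracket is `α [x, y]`. -/
def yauTwist {K g : Type*} [Field K] [LieRing g] [LieAlgebra K g] (α : g →ₗ⁅K⁆ g) :
    HomLieAlgebra K g where
  bracket := LinearMap.mk₂ K (fun x y => α ⁅x, y⁆)
    (by intros; simp) (by intros; simp) (by intros; simp) (by intros; simp)
  twist := (α : g →ₗ[K] g)
  skew := by
    intro x y
    simp only [LinearMap.mk₂_apply]
    rw [← lie_skew, map_neg]
  hom_jacobi := by
    intro x y z
    simp only [LinearMap.mk₂_apply, LieHom.coe_toLinearMap]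
    simp only [← LieHom.map_lie, ← map_add]
    rw [lie_jacobi]
    simp

theorem yauTwist_isMultiplicative {K g : Type*} [Field K] [LieRing g] [LieAlgebra K g]
    (α : g →ₗ⁅K⁆ g) : (yauTwist α).IsMultiplicative := by
  intro x y
  simp [yauTwist]

/-- A representation `(V, ρ_β, β)` of a Hom-Lie algebra: `action` is `ρ_β` and `beta` is `β`. -/
structure HomRep {K g : Type*} [Field K] [AddCommGroup g] [Module K g] (H : HomLieAlgebra K g)
    (V : Type*) [AddCommGroup V] [Module K V] where
  action : g →ₗ[K] Module.End K V
  beta : Module.End K V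
  action_twist : ∀ x, action (H.twist x) ∘ₗ beta = beta ∘ₗ action x
  action_bracket : ∀ x y, action (H.bracket x y) ∘ₗ beta
    = action (H.twist x) ∘ₗ action y - action (H.twist y) ∘ₗ action x

namespace HomRep

variable {K g : Type*} [Field K] [AddCommGroup g] [Module K g] {H : HomLieAlgebra K g}
  {V : Type*} [AddCommGroup V] [Module K V]

/-- `W` is invariant under the action and under `β`. -/
def IsSubrep (M : HomRep H V) (W : Submodule K V) : Prop :=
  (∀ x, ∀ w ∈ W, M.action x w ∈ W) ∧ ∀ w ∈ W, M.beta w ∈ W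

/-- There are precisely two subrepresentations, `0` and the whole space. -/
def IsIrreducible (M : HomRep H V) : Prop :=
  Nontrivial V ∧ ∀ W : Submodule K V, M.IsSubrep W → W = ⊥ ∨ W = ⊤

/-- The action `ρ = β⁻¹ ∘ ρ_β` of the induced Lie algebra; only used when `β` is invertible. -/
noncomputable def inducedAction (M : HomRep H V) (x : g) : Module.End K V :=
  Ring.inverse M.beta * M.action x

/-- The weight space of weight `χ` of the induced action, with respect to the subspace `𝔥`. -/
noncomputable def weightSpace (M : HomRep H V) (𝔥 : Submodule K g) (χ : Module.Dual K 𝔥) :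
    Submodule K V :=
  ⨅ x : 𝔥, Module.End.eigenspace (M.inducedAction x) (χ x)

/-- `β` is invertible, so that the induced Lie algebra acts by `β⁻¹ ∘ ρ_β`, and for that action
`V` is the sum of its weight spaces (the sum is then automatically direct). -/
def IsWeightModule (M : HomRep H V) (𝔥 : Submodule K g) : Prop :=
  IsUnit M.beta ∧ ⨆ χ : Module.Dual K 𝔥, M.weightSpace 𝔥 χ = ⊤

end HomRep

/-- The Lie algebra of traceless `2 × 2` matrices. -/
abbrev Sl2 (K : Type*) [Field K] : Type _ := LieAlgebra.SpecialLinear.sl (Fin 2) K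

section Sl2

variable (K : Type*) [Field K]

theorem mem_sl2_iff (A : Matrix (Fin 2) (Fin 2) K) :
    A ∈ LieAlgebra.SpecialLinear.sl (Fin 2) K ↔ A 0 0 + A 1 1 = 0 := by
  rw [← Matrix.trace_fin_two]
  exact LinearMap.mem_ker

def sl2E : Sl2 K := ⟨!![0, 1; 0, 0], (mem_sl2_iff K _).2 (by simp)⟩

def sl2F : Sl2 K := ⟨!![0, 0; 1, 0], (mem_sl2_iff K _).2 (by simp)⟩

def sl2H : Sl2 K := ⟨!![1, 0; 0, -1], (mem_sl2_iff K _).2 (by simp)⟩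

/-- The Cartan subalgebra spanned by `h`. -/
def sl2Cartan : Submodule K (Sl2 K) := Submodule.span K {sl2H K}

variable {K}

/-- The diagonal twist: the endomorphism of the Lie algebra with `e ↦ l e`, `f ↦ l⁻¹ f`,
`h ↦ h`. -/
def diagTwist (l : Kˣ) : Sl2 K →ₗ⁅K⁆ Sl2 K where
  toFun X := ⟨!![X.1 0 0, l * X.1 0 1; (l⁻¹ : Kˣ) * X.1 1 0, X.1 1 1],
    (mem_sl2_iff K _).2 (by simpa using (mem_sl2_iff K _).1 X.2)⟩
  map_add' X Y := by
    ext i j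
    fin_cases i <;> fin_cases j <;> simp [mul_add]
  map_smul' c X := by
    ext i j
    fin_cases i <;> fin_cases j <;> simp [mul_left_comm]
  map_lie' := by
    intro X Y
    ext i j
    have hl : (l : K) ≠ 0 := l.ne_zero
    fin_cases i <;> fin_cases j <;>
      simp [LieRing.of_associative_ring_bracket, Matrix.mul_apply, Fin.sum_univ_two] <;>
      field_simp

theorem diagTwist_e (l : Kˣ) : diagTwist l (sl2E K) = (l : K) • sl2E K := by
  ext i j
  fin_cases i <;> fin_cases j <;> simp [diagTwist, sl2E]

theorem diagTwist_f (l : Kˣ) : diagTwist l (sl2F K) = (l : K)⁻¹ • sl2F K := by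
  ext i j
  fin_cases i <;> fin_cases j <;> simp [diagTwist, sl2F]

theorem diagTwist_h (l : Kˣ) : diagTwist l (sl2H K) = sl2H K := by
  ext i j
  fin_cases i <;> fin_cases j <;> simp [diagTwist, sl2H]

/-- The diagonally twisted Hom-`sl(2)`. -/
def homSl2 (l : Kˣ) : HomLieAlgebra K (Sl2 K) := yauTwist (diagTwist l)

end Sl2

section Types

variable {K : Type*} [Field K] {l : Kˣ} {V : Type*} [AddCommGroup V] [Module K V]

/-- A lowest weight vector: a nonzero weight vector killed by `f`. -/
def IsLowestWeightVector (M : HomRep (homSl2 l) V) (v : V) : Prop :=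
  v ≠ 0 ∧ (∃ χ, v ∈ M.weightSpace (sl2Cartan K) χ) ∧ M.action (sl2F K) v = 0

/-- A highest weight vector: a nonzero weight vector killed by `e`. -/
def IsHighestWeightVector (M : HomRep (homSl2 l) V) (v : V) : Prop :=
  v ≠ 0 ∧ (∃ χ, v ∈ M.weightSpace (sl2Cartan K) χ) ∧ M.action (sl2E K) v = 0

/-- In a suitable basis `v_0, …, v_n`:
`h v_i = (2i - n) l^i b v_i`, `e v_i = l^(i+1) b v_(i+1)`, `e v_n = 0`,
`f v_i = i l^(i-1) b (n + 1 - i) v_(i-1)`, `f v_0 = 0`, `β v_i = l^i b v_i`. -/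
def HasFiniteForm (M : HomRep (homSl2 l) V) (n : ℕ) (b : K) : Prop :=
  ∃ v : Module.Basis (Fin (n + 1)) K V,
    (∀ i, M.action (sl2H K) (v i) = ((2 * (i : K) - n) * (l : K) ^ (i : ℕ) * b) • v i) ∧
    (∀ i : Fin n,
      M.action (sl2E K) (v i.castSucc) = ((l : K) ^ ((i : ℕ) + 1) * b) • v i.succ) ∧
    M.action (sl2E K) (v (Fin.last n)) = 0 ∧
    (∀ i : Fin n, M.action (sl2F K) (v i.succ)
      = (((i : K) + 1) * (l : K) ^ (i : ℕ) * b * ((n : K) - i)) • v i.castSucc) ∧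
    M.action (sl2F K) (v 0) = 0 ∧
    ∀ i, M.beta (v i) = ((l : K) ^ (i : ℕ) * b) • v i

/-- In a suitable basis `v_0, v_1, …`:
`h v_i = l^i b (τ + 2i) v_i`, `e v_i = l^(i+1) b v_(i+1)`,
`f v_i = -i l^(i-1) b (τ + i - 1) v_(i-1)`, `f v_0 = 0`, `β v_i = l^i b v_i`. -/
def HasLowestForm (M : HomRep (homSl2 l) V) (τ b : K) : Prop :=
  ∃ v : Module.Basis ℕ K V,
    (∀ i, M.action (sl2H K) (v i) = ((l : K) ^ i * b * (τ + 2 * i)) • v i) ∧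
    (∀ i, M.action (sl2E K) (v i) = ((l : K) ^ (i + 1) * b) • v (i + 1)) ∧
    (∀ i : ℕ, M.action (sl2F K) (v (i + 1))
      = (-(((i : K) + 1) * (l : K) ^ i * b * (τ + i))) • v i) ∧
    M.action (sl2F K) (v 0) = 0 ∧
    ∀ i, M.beta (v i) = ((l : K) ^ i * b) • v i

/-- In a suitable basis `v_0, v_1, …`:
`h v_i = l^(-i) b (τ - 2i) v_i`, `f v_i = l^(-i-1) b v_(i+1)`,
`e v_i = i l^(-i+1) b (τ - i + 1) v_(i-1)`, `e v_0 = 0`, `β v_i = l^(-i) b v_i`. -/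
def HasHighestForm (M : HomRep (homSl2 l) V) (τ b : K) : Prop :=
  ∃ v : Module.Basis ℕ K V,
    (∀ i, M.action (sl2H K) (v i) = ((l : K) ^ (-(i : ℤ)) * b * (τ - 2 * i)) • v i) ∧
    (∀ i, M.action (sl2F K) (v i) = ((l : K) ^ (-(i : ℤ) - 1) * b) • v (i + 1)) ∧
    (∀ i : ℕ, M.action (sl2E K) (v (i + 1))
      = (((i : K) + 1) * (l : K) ^ (-(i : ℤ)) * b * (τ - i)) • v i) ∧
    M.action (sl2E K) (v 0) = 0 ∧
    ∀ i, M.beta (v i) = ((l : K) ^ (-(i : ℤ)) * b) • v i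

/-- In a suitable basis `(v_i)`, `i ∈ ℤ`: `h v_i = l^i b (τ + 2i) v_i`,
`e v_i = l^(i+1) b v_(i+1)` for `i ≥ 0`, `f v_i = l^(i-1) b v_(i-1)` for `i ≤ 0`,
`e v_i = (μ - (τ + 2i + 1)² + 1)/4 · l^(i+1) b v_(i+1)` for `i < 0`,
`f v_i = (μ - (τ + 2i - 1)² + 1)/4 · l^(i-1) b v_(i-1)` for `i > 0`, `β v_i = l^i b v_i`. -/
def HasIntermediateForm (M : HomRep (homSl2 l) V) (τ μ b : K) : Prop :=
  ∃ v : Module.Basis ℤ K V,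
    (∀ i, M.action (sl2H K) (v i) = ((l : K) ^ i * b * (τ + 2 * i)) • v i) ∧
    (∀ i, 0 ≤ i → M.action (sl2E K) (v i) = ((l : K) ^ (i + 1) * b) • v (i + 1)) ∧
    (∀ i, i ≤ 0 → M.action (sl2F K) (v i) = ((l : K) ^ (i - 1) * b) • v (i - 1)) ∧
    (∀ i, i < 0 → M.action (sl2E K) (v i)
      = ((μ - (τ + 2 * i + 1) ^ 2 + 1) / 4 * (l : K) ^ (i + 1) * b) • v (i + 1)) ∧
    (∀ i, 0 < i → M.action (sl2F K) (v i)
      = ((μ - (τ + 2 * i - 1) ^ 2 + 1) / 4 * (l : K) ^ (i - 1) * b) • v (i - 1)) ∧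
    ∀ i, M.beta (v i) = ((l : K) ^ i * b) • v i

/-- The finite-dimensional type. -/
def IsFiniteType (M : HomRep (homSl2 l) V) : Prop :=
  ∃ (n : ℕ) (b : K), b ≠ 0 ∧ HasFiniteForm M n b

/-- The lowest weight type: `τ` is not one of `0, -1, -2, …`. -/
def IsLowestType (M : HomRep (homSl2 l) V) : Prop :=
  ∃ τ b : K, b ≠ 0 ∧ (∀ m : ℕ, τ ≠ -m) ∧ HasLowestForm M τ b

/-- The highest weight type: `τ` is not one of `0, 1, 2, …`. -/
def IsHighestType (M : HomRep (homSl2 l) V) : Prop :=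
  ∃ τ b : K, b ≠ 0 ∧ (∀ m : ℕ, τ ≠ m) ∧ HasHighestForm M τ b

/-- The intermediate series: no square root of `μ + 1` lies in `τ + 1 + 2ℤ`. -/
def IsIntermediateType (M : HomRep (homSl2 l) V) : Prop :=
  ∃ τ μ b : K, b ≠ 0 ∧ (∀ i : ℤ, (τ + 2 * i + 1) ^ 2 ≠ μ + 1) ∧ HasIntermediateForm M τ μ b

end Types

end HomLie

/-! When `β` is invertible, `e, f, h` acting through `β⁻¹ ∘ ρ_β` satisfy the usual `sl(2)`
relations, and `β` intertwines this action with its twist by `l`. The catch is that a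
subrepresentation is stable under `β`, `β e`, `β f`, `β h`, but in infinite dimension not a priori
under `β⁻¹`, hence not under `e, f, h`. Nor are weight spaces known to be finite-dimensional. The
argument therefore runs with `E = β e` and `F = β f`, for which `F E = l² E F - l β² h`.

Let `U` be a weight space. A subspace `W` of `U` stable under `β` and `F E` generates the
subrepresentation `∑ E^k W + ∑ F^k W`, which meets `U` only in `W`, because `E` and `F` shift
weights by `±2`. So irreducibility of `V` makes `U` simple for the commuting pair `β`, `F E`, and a
Schur lemma resting on Zariski's lemma, valid in any dimension, makes both scalars. Hence every
weight vector `v` is an eigenvector of `β` and of `f e`, and the vectors `e^k v`, `f^k v` span `V`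
(`weightVector_generates`).

If `f` kills a weight vector `v` of weight `t`, the nonzero `e^k v` form a basis, and `f e^(k+1) v =
-(k+1)(t+k) e^k v` ties termination to `t`. If `e` kills one, exchange `e` with `f`, `h` with `-h`
and `l` with `l⁻¹`. Otherwise the two-sided ladder through any weight vector is a basis, and its
coefficients are dictated by the value `μ` of the Casimir operator `4 f e + h² + 2 h`.

Conversely, the listed bases consist of weight vectors of distinct weights. A nonzero
subrepresentation contains one of them (`exists_basis_mem`), and the conditions on the parameters
keep the coefficients nonzero, so it contains them all. Dimension and the presence of lowest or
highest weight vectors tell the types apart. -/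

namespace HomLie

/-! ### A Schur lemma for two commuting operators -/

/-- Over an algebraically closed field, two commuting endomorphisms without common proper
invariant subspaces are scalars. -/
theorem exists_scalars_of_commute {K U : Type*} [Field K] [IsAlgClosed K] [AddCommGroup U]
    [Module K U] [Nontrivial U] (A B : Module.End K U) (hAB : Commute A B)
    (hs : ∀ W : Submodule K U, (∀ w ∈ W, A w ∈ W) → (∀ w ∈ W, B w ∈ W) → W = ⊥ ∨ W = ⊤) :
    ∃ a b : K, (∀ u, A u = a • u) ∧ ∀ u, B u = b • u := by
  have hcomm : ∀ x ∈ ({A, B} : Set (Module.End K U)), ∀ y ∈ ({A, B} : Set (Module.End K U)),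
      x * y = y * x := by
    rintro x (rfl | rfl) y (rfl | rfl)
    · rfl
    · exact hAB
    · exact hAB.symm
    · rfl
  set S := Algebra.adjoin K ({A, B} : Set (Module.End K U)) with hS
  have : IsMulCommutative S := Algebra.isMulCommutative_adjoin K hcomm
  have hA : A ∈ S := Algebra.subset_adjoin (by simp)
  have hB : B ∈ S := Algebra.subset_adjoin (by simp)
  have hSc : ∀ x ∈ S, ∀ y ∈ S, ∀ u, x (y u) = y (x u) := by
    intro x hx y hy u
    have h : (⟨x, hx⟩ : S) * ⟨y, hy⟩ = ⟨y, hy⟩ * ⟨x, hx⟩ :=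
      IsMulCommutative.is_comm.comm _ _
    exact congrArg (fun s : S => (s : Module.End K U) u) h
  obtain ⟨m, hm⟩ := exists_ne (0 : U)
  have hgen : ∀ u, u ≠ 0 → ∀ z, ∃ x ∈ S, x u = z := by
    intro u hu z
    have h := hs (S.toSubmodule.map (LinearMap.applyₗ u))
      (by
        rintro _ ⟨x, hx, rfl⟩
        exact ⟨A * x, S.mul_mem hA hx, rfl⟩)
      (by
        rintro _ ⟨x, hx, rfl⟩
        exact ⟨B * x, S.mul_mem hB hx, rfl⟩)
    rcases h with h | h
    · exact absurd ((Submodule.eq_bot_iff _).1 h u ⟨1, S.one_mem, rfl⟩) hu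
    · have : z ∈ S.toSubmodule.map (LinearMap.applyₗ u) := h ▸ Submodule.mem_top
      obtain ⟨x, hx, rfl⟩ := this
      exact ⟨x, hx, rfl⟩
  -- By commutativity, what kills a generator kills everything.
  have hzero : ∀ x ∈ S, x m = 0 → x = 0 := by
    intro x hx hxm
    ext z
    obtain ⟨y, hy, rfl⟩ := hgen m hm z
    rw [hSc x hx y hy, hxm]
    simp
  have hfield : IsField S := by
    refine ⟨⟨0, 1, fun h => ?_⟩, IsMulCommutative.is_comm.comm, ?_⟩
    · have := congrArg (fun s : S => (s : Module.End K U) m) h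
      exact hm this.symm
    · rintro ⟨x, hx⟩ hx0
      have hxm : x m ≠ 0 := fun h => hx0 (Subtype.ext (hzero x hx h))
      -- `x m` generates as well, so some `y` brings it back to `m`; then `x y - 1` kills `m` and is
      -- zero.
      obtain ⟨y, hy, hyx⟩ := hgen (x m) hxm m
      refine ⟨⟨y, hy⟩, Subtype.ext (sub_eq_zero.1 (hzero (x * y - 1) ?_ ?_))⟩
      · exact S.sub_mem (S.mul_mem hx hy) S.one_mem
      · simp [hSc x hx y hy, hyx]
  let _ : Field S := hfield.toField
  have : Algebra.FiniteType K S :=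
    (Subalgebra.fg_iff_finiteType _).1 (Subalgebra.fg_def.2 ⟨_, Set.toFinite _, hS.symm⟩)
  -- Zariski's lemma: a field that is finitely generated as a `K`-algebra is finite over `K`,
  -- whatever the dimension of `U`.
  have : Module.Finite K S := finite_of_finite_type_of_isJacobsonRing K S
  have hbij := IsAlgClosed.algebraMap_bijective_of_isIntegral (k := K) (K := S)
  obtain ⟨a, ha⟩ := hbij.2 ⟨A, hA⟩
  obtain ⟨b, hb⟩ := hbij.2 ⟨B, hB⟩
  refine ⟨a, b, fun u => ?_, fun u => ?_⟩
  · have := congrArg (fun s : S => (s : Module.End K U) u) ha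
    exact this.symm
  · have := congrArg (fun s : S => (s : Module.End K U) u) hb
    exact this.symm

/-! ### Twisted triples and the subrepresentation generated by part of a weight space -/

/-- A triple `e, f, h` of endomorphisms with the `sl(2)` relations, and an injective endomorphism
`β` that intertwines it with its twist by `l`. -/
structure TwistedTriple {K V : Type*} [Field K] [AddCommGroup V] [Module K V] (l : Kˣ)
    (β e f h : Module.End K V) : Prop where
  inj : Function.Injective β
  beta_e : ∀ v, β (e v) = (l : K) • e (β v)
  beta_f : ∀ v, β (f v) = (l : K)⁻¹ • f (β v)
  beta_h : ∀ v, β (h v) = h (β v)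
  he : ∀ v, h (e v) = e (h v) + (2 : K) • e v
  hf : ∀ v, h (f v) = f (h v) - (2 : K) • f v
  ef : ∀ v, e (f v) = f (e v) + h v

/-- The submodule is invariant under `β`, `β e`, `β f` and `β h`. -/
structure IsTwistInvariant {K V : Type*} [Field K] [AddCommGroup V] [Module K V]
    (β e f h : Module.End K V) (W : Submodule K V) : Prop where
  beta_mem : ∀ w ∈ W, β w ∈ W
  e_mem : ∀ w ∈ W, β (e w) ∈ W
  f_mem : ∀ w ∈ W, β (f w) ∈ W
  h_mem : ∀ w ∈ W, β (h w) ∈ W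

/-- No proper nonzero submodule is invariant under `β`, `β e`, `β f` and `β h`. -/
def IsTwistSimple {K V : Type*} [Field K] [AddCommGroup V] [Module K V]
    (β e f h : Module.End K V) : Prop :=
  ∀ W : Submodule K V, IsTwistInvariant β e f h W → W = ⊥ ∨ W = ⊤

section Triple

variable {K V : Type*} [Field K] [AddCommGroup V] [Module K V] {l : Kˣ}
  {β e f h : Module.End K V}

/-- The Chevalley involution. It turns every statement about `e` and lowest weights into one about
`f` and highest weights. -/
theorem TwistedTriple.dual (T : TwistedTriple l β e f h) : TwistedTriple l⁻¹ β f e (-h) where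
  inj := T.inj
  beta_e v := by simpa using T.beta_f v
  beta_f v := by simpa using T.beta_e v
  beta_h v := by simpa using T.beta_h v
  he v := by
    simp only [LinearMap.neg_apply, T.hf, map_neg]
    abel
  hf v := by
    simp only [LinearMap.neg_apply, T.he, map_neg]
    abel
  ef v := by simp [T.ef]

theorem IsTwistSimple.dual (S : IsTwistSimple β e f h) : IsTwistSimple β f e (-h) :=
  fun W hW => S W ⟨hW.beta_mem, hW.f_mem, hW.e_mem,
    fun w hw => by simpa using W.neg_mem (hW.h_mem w hw)⟩

namespace TwistedTriple

theorem h_pow_e (T : TwistedTriple l β e f h) {t : K} {v : V} (hv : h v = t • v) (k : ℕ) :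
    h ((e ^ k) v) = (t + 2 * k) • (e ^ k) v := by
  induction k with
  | zero => simp [hv]
  | succ k ih =>
    rw [pow_succ', Module.End.mul_apply, T.he, ih, map_smul, ← add_smul]
    push_cast
    congr 1
    ring

theorem h_pow_beta_e (T : TwistedTriple l β e f h) {t : K} {v : V} (hv : h v = t • v) (k : ℕ) :
    h (((β * e) ^ k) v) = (t + 2 * k) • ((β * e) ^ k) v := by
  induction k with
  | zero => simp [hv]
  | succ k ih =>
    rw [pow_succ', Module.End.mul_apply, Module.End.mul_apply, ← T.beta_h, T.he, ih, map_smul,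
      ← add_smul, map_smul]
    push_cast
    congr 1
    ring

theorem beta_pow_beta_e (T : TwistedTriple l β e f h) (v : V) (k : ℕ) :
    β (((β * e) ^ k) v) = ((l : K) ^ k) • ((β * e) ^ k) (β v) := by
  induction k with
  | zero => simp
  | succ k ih =>
    simp only [pow_succ' (β * e), Module.End.mul_apply]
    rw [T.beta_e, ih]
    simp only [map_smul, smul_smul]
    congr 1
    ring

theorem beta_pow_e (T : TwistedTriple l β e f h) {b : K} {v : V} (hv : β v = b • v) (k : ℕ) :
    β ((e ^ k) v) = ((l : K) ^ k * b) • (e ^ k) v := by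
  induction k with
  | zero => simp [hv]
  | succ k ih =>
    rw [pow_succ', Module.End.mul_apply, T.beta_e, ih, map_smul, smul_smul]
    congr 1
    ring

/-- Moving `f` past one more `e` costs the current weight, so `c` is diminished by the sum of `t + 2
j` over `1 ≤ j ≤ k`. -/
theorem f_pow_e (T : TwistedTriple l β e f h) {t c : K} {v : V} (hv : h v = t • v)
    (hc : f (e v) = c • v) (k : ℕ) :
    f ((e ^ (k + 1)) v) = (c - k * t - k * (k + 1)) • (e ^ k) v := by
  induction k with
  | zero => simp [hc]
  | succ k ih =>
    have h1 := T.ef ((e ^ (k + 1)) v)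
    have h2 : f ((e ^ (k + 1 + 1)) v) = e (f ((e ^ (k + 1)) v)) - h ((e ^ (k + 1)) v) := by
      rw [pow_succ' e (k + 1), Module.End.mul_apply, h1]
      abel
    rw [h2, ih, T.h_pow_e hv, map_smul, ← Module.End.mul_apply, ← pow_succ', ← sub_smul]
    push_cast
    congr 1
    ring

/-- The relation `[e, f] = h` rewritten for `E = β e` and `F = β f`, the operators under which
subrepresentations are known to be stable. -/
theorem beta_f_beta_e (T : TwistedTriple l β e f h) (v : V) :
    β (f (β (e v))) = (l : K) ^ 2 • β (e (β (f v))) - (l : K) • β (β (h v)) := by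
  have hl : (l : K) ≠ 0 := l.ne_zero
  have h1 : f (β (e v)) = (l : K) • β (f (e v)) := by
    rw [T.beta_f, smul_smul, mul_inv_cancel₀ hl, one_smul]
  have h2 : e (β (f v)) = (l : K)⁻¹ • β (e (f v)) := by
    rw [T.beta_e, smul_smul, inv_mul_cancel₀ hl, one_smul]
  rw [h1, h2, T.ef]
  simp only [map_smul, map_add, smul_smul]
  rw [show (l : K) ^ 2 * (l : K)⁻¹ = l by field_simp]
  module

/-- Induction on `F E = l² E F - l β² h`: the first term falls to the induction hypothesis, and `β²
h` acts on `E^k W` through `β` on `W`, up to scalars. -/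
theorem beta_f_pow_mem (T : TwistedTriple l β e f h) {t : K} {W : Submodule K V}
    (hW : ∀ w ∈ W, h w = t • w) (hβ : ∀ w ∈ W, β w ∈ W) (hfe : ∀ w ∈ W, β (f (β (e w))) ∈ W)
    (k : ℕ) : ∀ w ∈ W, β (f (((β * e) ^ (k + 1)) w)) ∈ W.map ((β * e) ^ k) := by
  induction k with
  | zero =>
    intro w hw
    exact ⟨_, hfe w hw, by simp⟩
  | succ k ih =>
    intro w hw
    rw [pow_succ' (β * e) (k + 1), Module.End.mul_apply, Module.End.mul_apply, T.beta_f_beta_e]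
    refine Submodule.sub_mem _ (Submodule.smul_mem _ _ ?_) (Submodule.smul_mem _ _ ?_)
    · obtain ⟨w', hw', hww⟩ := ih w hw
      refine ⟨w', hw', ?_⟩
      rw [← hww, pow_succ' (β * e), Module.End.mul_apply, Module.End.mul_apply]
    · rw [T.h_pow_beta_e (hW w hw), map_smul, map_smul, T.beta_pow_beta_e, map_smul,
        T.beta_pow_beta_e]
      exact Submodule.smul_mem _ _ (Submodule.smul_mem _ _ (Submodule.smul_mem _ _
        ⟨_, hβ _ (hβ w hw), rfl⟩))

/-- The submodule generated by `W` under the positive powers of `β e` and of `β f`. -/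
def _root_.HomLie.twistSpan (β e f : Module.End K V) (W : Submodule K V) : Submodule K V :=
  (⨆ k : ℕ, W.map ((β * e) ^ k)) ⊔ ⨆ k : ℕ, W.map ((β * f) ^ k)

theorem _root_.HomLie.le_twistSpan (β e f : Module.End K V) (W : Submodule K V) :
    W ≤ twistSpan β e f W := by
  refine le_trans ?_ le_sup_left
  refine le_trans ?_ (le_iSup _ 0)
  intro w hw
  exact ⟨w, hw, by simp⟩

theorem map_pow_le_comap (T : TwistedTriple l β e f h) {t : K} {W : Submodule K V}
    (hW : ∀ w ∈ W, h w = t • w) (hβ : ∀ w ∈ W, β w ∈ W) (hfe : ∀ w ∈ W, β (f (β (e w))) ∈ W)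
    (k : ℕ) : W.map ((β * e) ^ k) ≤ (twistSpan β e f W).comap β ⊓
      (twistSpan β e f W).comap (β * e) ⊓ (twistSpan β e f W).comap (β * f) ⊓
      (twistSpan β e f W).comap (β * h) := by
  have hE : ∀ k, W.map ((β * e) ^ k) ≤ twistSpan β e f W := fun k =>
    (le_iSup (fun k : ℕ => W.map ((β * e) ^ k)) k).trans le_sup_left
  have hF : ∀ k, W.map ((β * f) ^ k) ≤ twistSpan β e f W := fun k =>
    (le_iSup (fun k : ℕ => W.map ((β * f) ^ k)) k).trans le_sup_right
  rintro _ ⟨w, hw, rfl⟩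
  have hb : β (((β * e) ^ k) w) ∈ twistSpan β e f W := by
    rw [T.beta_pow_beta_e]
    exact Submodule.smul_mem _ _ (hE k ⟨_, hβ w hw, rfl⟩)
  refine ⟨⟨⟨hb, ?_⟩, ?_⟩, ?_⟩
  · refine hE (k + 1) ⟨w, hw, ?_⟩
    rw [pow_succ', Module.End.mul_apply]
  -- `F` carries the bottom term `W` into the other half of the sum and lowers every higher term by
  -- one power of `E`.
  · cases k with
    | zero => exact hF 1 ⟨w, hw, by simp⟩
    | succ k => exact hE k (T.beta_f_pow_mem hW hβ hfe k w hw)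
  · change β (h (((β * e) ^ k) w)) ∈ twistSpan β e f W
    rw [T.h_pow_beta_e (hW w hw), map_smul]
    exact Submodule.smul_mem _ _ hb

/-- `E F` and `F E` differ on a weight space by scalars and `β²`, so the hypothesis on `W` is
symmetric under `dual`. -/
theorem beta_e_beta_f_mem (T : TwistedTriple l β e f h) {t : K} {W : Submodule K V}
    (hW : ∀ w ∈ W, h w = t • w) (hβ : ∀ w ∈ W, β w ∈ W) (hfe : ∀ w ∈ W, β (f (β (e w))) ∈ W) :
    ∀ w ∈ W, β (e (β (f w))) ∈ W := by
  intro w hw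
  have := T.dual.beta_f_beta_e w
  rw [this]
  refine W.sub_mem (W.smul_mem _ (hfe w hw)) (W.smul_mem _ (hβ _ (hβ _ ?_)))
  simpa [hW w hw] using W.smul_mem t hw

theorem isTwistInvariant_twistSpan (T : TwistedTriple l β e f h) {t : K} {W : Submodule K V}
    (hW : ∀ w ∈ W, h w = t • w) (hβ : ∀ w ∈ W, β w ∈ W)
    (hfe : ∀ w ∈ W, β (f (β (e w))) ∈ W) :
    IsTwistInvariant β e f h (twistSpan β e f W) := by
  have h1 := iSup_le (T.map_pow_le_comap hW hβ hfe)
  have h2 := iSup_le (T.dual.map_pow_le_comap (t := -t) (W := W)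
    (fun w hw => by simp [hW w hw]) hβ (T.beta_e_beta_f_mem hW hβ hfe))
  have h3 : twistSpan β f e W = twistSpan β e f W := sup_comm _ _
  rw [h3] at h2
  have h4 : twistSpan β e f W ≤ (twistSpan β e f W).comap β ⊓
      (twistSpan β e f W).comap (β * e) ⊓ (twistSpan β e f W).comap (β * f) ⊓
      (twistSpan β e f W).comap (β * h) := by
    refine sup_le h1 (h2.trans ?_)
    intro w hw
    refine ⟨⟨⟨hw.1.1.1, hw.1.2⟩, hw.1.1.2⟩, ?_⟩
    simpa using hw.2
  exact ⟨fun w hw => (h4 hw).1.1.1, fun w hw => (h4 hw).1.1.2, fun w hw => (h4 hw).1.2,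
    fun w hw => (h4 hw).2⟩

theorem map_pow_le_sup [CharZero K] (T : TwistedTriple l β e f h) {t : K} {W : Submodule K V}
    (hW : ∀ w ∈ W, h w = t • w) (k : ℕ) :
    W.map ((β * e) ^ k) ≤ W ⊔ ⨆ s, ⨆ _ : s ≠ t, Module.End.eigenspace h s := by
  rintro _ ⟨w, hw, rfl⟩
  cases k with
  | zero => exact Submodule.mem_sup_left (by simpa using hw)
  | succ k =>
    refine Submodule.mem_sup_right ?_
    have hne : t + 2 * ((k + 1 : ℕ) : K) ≠ t := by
      intro h0
      have : (2 * ((k + 1 : ℕ) : K)) = 0 := by linear_combination h0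
      norm_cast at this
    refine Submodule.mem_iSup_of_mem _ (Submodule.mem_iSup_of_mem hne ?_)
    exact Module.End.mem_eigenspace_iff.2 (T.h_pow_beta_e (hW w hw) (k + 1))

/-- Every term other than `W` itself lies in eigenspaces for weights different from `t`, and
eigenspaces are independent. Thus `W` can be recovered from the subrepresentation that it generates.
-/
theorem twistSpan_inf_eigenspace_le [CharZero K] (T : TwistedTriple l β e f h) {t : K}
    {W : Submodule K V} (hW : ∀ w ∈ W, h w = t • w) :
    twistSpan β e f W ⊓ Module.End.eigenspace h t ≤ W := by
  have h1 : ∀ k : ℕ, W.map ((β * f) ^ k) ≤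
      W ⊔ ⨆ s, ⨆ _ : s ≠ t, Module.End.eigenspace h s := fun k => by
    refine (T.dual.map_pow_le_sup (t := -t) (fun w hw => by simp [hW w hw]) k).trans ?_
    refine sup_le_sup_left (iSup₂_le fun s hs => ?_) _
    refine le_trans ?_ (le_iSup₂_of_le (-s) (fun h => hs (by rw [← h, neg_neg])) le_rfl)
    intro w hw
    rw [Module.End.mem_eigenspace_iff] at hw ⊢
    rw [neg_smul, ← hw]
    simp
  have h2 : twistSpan β e f W ≤ W ⊔ ⨆ s, ⨆ _ : s ≠ t, Module.End.eigenspace h s :=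
    sup_le (iSup_le (T.map_pow_le_sup hW)) (iSup_le h1)
  have hWt : W ≤ Module.End.eigenspace h t := fun w hw =>
    Module.End.mem_eigenspace_iff.2 (hW w hw)
  refine (inf_le_inf_right _ h2).trans ?_
  rw [sup_inf_assoc_of_le _ hWt]
  refine sup_le le_rfl ?_
  rw [((Module.End.eigenspaces_iSupIndep h) t).symm.eq_bot]
  exact bot_le

/-- On an eigenvector of `β`, passing from powers of `e` to powers of `β e` only changes scalars. -/
theorem span_pow_eq (T : TwistedTriple l β e f h) {b : K} {v : V} (hv : β v = b • v) (k : ℕ) :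
    ((β * e) ^ k) v ∈ K ∙ ((e ^ k) v) := by
  induction k with
  | zero => simp [Submodule.mem_span_singleton_self]
  | succ k ih =>
    obtain ⟨c, hc⟩ := Submodule.mem_span_singleton.1 ih
    rw [pow_succ' (β * e), Module.End.mul_apply, ← hc, map_smul, Module.End.mul_apply,
      ← Module.End.mul_apply e, ← pow_succ' e, T.beta_pow_e hv]
    exact Submodule.smul_mem _ _ (Submodule.smul_mem _ _ (Submodule.mem_span_singleton_self _))

/-- In a simple twisted module every weight vector is an eigenvector of `β` and of `f e`, and its
images under the powers of `e` and of `f` span. -/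
theorem weightVector_generates [IsAlgClosed K] [CharZero K] (T : TwistedTriple l β e f h)
    (S : IsTwistSimple β e f h) {t : K} {v : V} (hv0 : v ≠ 0) (hv : h v = t • v) :
    ∃ b c : K, b ≠ 0 ∧ β v = b • v ∧ f (e v) = c • v ∧
      Submodule.span K (Set.range fun k : ℕ => (e ^ k) v) ⊔
        Submodule.span K (Set.range fun k : ℕ => (f ^ k) v) = ⊤ := by
  have hl : (l : K) ≠ 0 := l.ne_zero
  set U := Module.End.eigenspace h t with hU
  have hmem : ∀ u, u ∈ U ↔ h u = t • u := fun u => Module.End.mem_eigenspace_iff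
  have hUβ : ∀ u ∈ U, β u ∈ U := by
    intro u hu
    rw [hmem] at hu ⊢
    rw [← T.beta_h, hu, map_smul]
  have hUfe' : ∀ u ∈ U, f (e u) ∈ U := by
    intro u hu
    rw [hmem] at hu ⊢
    rw [T.hf, T.he, hu, map_add, map_smul, map_smul, map_smul]
    abel
  -- `F E` equals `l β² f e`; it therefore commutes with `β`, and its scalar determines that of `f
  -- e`.
  have hN : ∀ u, (β * f * β * e) u = (l : K) • β (β (f (e u))) := by
    intro u
    simp only [Module.End.mul_apply]
    rw [T.beta_f (e u), map_smul, smul_smul, mul_inv_cancel₀ hl, one_smul]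
  have hUN : ∀ u ∈ U, (β * f * β * e) u ∈ U := by
    intro u hu
    rw [hN]
    exact U.smul_mem _ (hUβ _ (hUβ _ (hUfe' _ hu)))
  have : Nontrivial U := ⟨⟨⟨v, (hmem v).2 hv⟩, 0, fun h => hv0 (congrArg Subtype.val h)⟩⟩
  have hcomm : Commute (β.restrict hUβ) ((β * f * β * e).restrict hUN) := by
    ext u
    change β ((β * f * β * e) u) = (β * f * β * e) (β u)
    rw [hN, hN]
    have h1 : f (e (β u)) = β (f (e u)) := by
      rw [T.beta_f, T.beta_e, map_smul, smul_smul, inv_mul_cancel₀ hl, one_smul]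
    rw [h1, map_smul]
  obtain ⟨b, n, hb, hn⟩ := exists_scalars_of_commute (β.restrict hUβ)
    ((β * f * β * e).restrict hUN) hcomm (by
      intro W hWβ hWN
      have hW : ∀ w ∈ W.map U.subtype, h w = t • w := by
        rintro _ ⟨w, -, rfl⟩
        exact (hmem _).1 w.2
      have hinv := T.isTwistInvariant_twistSpan hW
        (by
          rintro _ ⟨w, hw, rfl⟩
          exact ⟨_, hWβ w hw, rfl⟩)
        (by
          rintro _ ⟨w, hw, rfl⟩
          exact ⟨_, hWN w hw, rfl⟩)
      rcases S _ hinv with h0 | h0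
      · left
        have := le_bot_iff.1 ((le_twistSpan β e f (W.map U.subtype)).trans h0.le)
        exact Submodule.map_injective_of_injective U.injective_subtype
          (this.trans (Submodule.map_bot _).symm)
      · right
        have h1 := T.twistSpan_inf_eigenspace_le hW
        rw [h0, top_inf_eq] at h1
        rw [eq_top_iff]
        rintro u -
        obtain ⟨w, hw, hwu⟩ := h1 u.2
        rwa [← Subtype.ext hwu])
  have hb' : ∀ u ∈ U, β u = b • u := fun u hu => congrArg Subtype.val (hb ⟨u, hu⟩)
  have hn' : ∀ u ∈ U, (β * f * β * e) u = n • u := fun u hu => congrArg Subtype.val (hn ⟨u, hu⟩)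
  have hvU : v ∈ U := (hmem v).2 hv
  have hb0 : b ≠ 0 := by
    rintro rfl
    refine hv0 (T.inj ?_)
    rw [hb' v hvU, zero_smul, map_zero]
  -- `n = l b² c`, solved for `c`.
  refine ⟨b, ((l : K) * b ^ 2)⁻¹ * n, hb0, hb' v hvU, ?_, ?_⟩
  · have h1 := hn' v hvU
    rw [hN, hb' _ (hUfe' v hvU), map_smul, hb' _ (hUfe' v hvU), smul_smul, smul_smul] at h1
    rw [mul_smul, ← h1, smul_smul]
    rw [show ((l : K) * b ^ 2)⁻¹ * (l * b * b) = 1 by field_simp, one_smul]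
  -- Now that `β` and `F E` are scalars on the weight space, the line through `v` is itself an
  -- admissible `W`, so it generates everything.
  · have hW : ∀ w ∈ K ∙ v, h w = t • w := by
      intro w hw
      obtain ⟨c, rfl⟩ := Submodule.mem_span_singleton.1 hw
      rw [map_smul, hv, smul_comm]
    have hinv := T.isTwistInvariant_twistSpan hW
        (fun w hw => by
          rw [hb' w ((hmem w).2 (hW w hw))]
          exact Submodule.smul_mem _ _ hw)
        (fun w hw => by
          have := hn' w ((hmem w).2 (hW w hw))
          simp only [Module.End.mul_apply] at this
          rw [this]
          exact Submodule.smul_mem _ _ hw)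
    rcases S _ hinv with h0 | h0
    · have := le_twistSpan β e f _ (Submodule.mem_span_singleton_self v)
      rw [h0] at this
      exact absurd this hv0
    · rw [eq_top_iff, ← h0]
      refine sup_le_sup (iSup_le fun k => ?_) (iSup_le fun k => ?_)
      · rw [Submodule.map_span, Set.image_singleton, Submodule.span_singleton_le_iff_mem]
        exact Submodule.span_mono (Set.singleton_subset_iff.2 (Set.mem_range_self k))
          (T.span_pow_eq (hb' v hvU) k)
      · rw [Submodule.map_span, Set.image_singleton, Submodule.span_singleton_le_iff_mem]
        exact Submodule.span_mono (Set.singleton_subset_iff.2 (Set.mem_range_self k))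
          (T.dual.span_pow_eq (hb' v hvU) k)

end TwistedTriple

end Triple

/-! ### Bases from lowest weight vectors and from ladders -/

section Bases

variable {K V : Type*} [Field K] [AddCommGroup V] [Module K V] {l : Kˣ}
  {β e f h : Module.End K V}

namespace TwistedTriple

theorem f_pow_e_lowest (T : TwistedTriple l β e f h) {t : K} {v : V} (hv : h v = t • v)
    (hf : f v = 0) (k : ℕ) :
    f ((e ^ (k + 1)) v) = (-((k + 1) * (t + k))) • (e ^ k) v := by
  have hc : f (e v) = (-t) • v := by
    have := T.ef v
    rw [hf, map_zero, hv] at this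
    rw [neg_smul]
    exact eq_neg_of_add_eq_zero_left this.symm
  rw [T.f_pow_e hv hc]
  congr 1
  ring

theorem pow_e_eq_zero_of_le {v : V} {m k : ℕ} (hm : (e ^ m) v = 0) (hk : m ≤ k) :
    (e ^ k) v = 0 := by
  obtain ⟨j, rfl⟩ := Nat.exists_eq_add_of_le' hk
  rw [pow_add, Module.End.mul_apply, hm, map_zero]

theorem linearIndependent_pow_e [CharZero K] (T : TwistedTriple l β e f h) {t : K} {v : V}
    (hv : h v = t • v) {ι : Type*} (c : ι → ℕ) (hc : Function.Injective c)
    (hne : ∀ i, (e ^ c i) v ≠ 0) : LinearIndependent K fun i => (e ^ c i) v := by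
  refine Module.End.eigenvectors_linearIndependent' h (fun i => t + 2 * (c i : K)) ?_ _
    fun i => ⟨Module.End.mem_eigenspace_iff.2 (T.h_pow_e hv (c i)), hne i⟩
  intro i j hij
  have : (2 : K) * (c i : K) = 2 * c j := by linear_combination hij
  exact hc (Nat.cast_injective (mul_left_cancel₀ two_ne_zero this))

theorem span_pow_e_of_lowest [IsAlgClosed K] [CharZero K] (T : TwistedTriple l β e f h)
    (S : IsTwistSimple β e f h) {t : K} {v : V} (hv0 : v ≠ 0) (hv : h v = t • v) (hf : f v = 0) :
    Submodule.span K (Set.range fun k : ℕ => (e ^ k) v) = ⊤ := by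
  obtain ⟨b, c, -, -, -, hs⟩ := T.weightVector_generates S hv0 hv
  rw [eq_top_iff, ← hs]
  refine sup_le le_rfl (Submodule.span_le.2 ?_)
  rintro _ ⟨k, rfl⟩
  rcases k with _ | k
  · exact Submodule.subset_span ⟨0, by simp⟩
  · have : (f ^ (k + 1)) v = 0 := by rw [pow_succ, Module.End.mul_apply, hf, map_zero]
    simp [this]

/-- A simple twisted module with a lowest weight vector has a basis of images of this vector under
the powers of `e`. -/
theorem exists_basis_of_lowest [IsAlgClosed K] [CharZero K] (T : TwistedTriple l β e f h)
    (S : IsTwistSimple β e f h) {t : K} {v : V} (hv0 : v ≠ 0) (hv : h v = t • v) (hf : f v = 0) :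
    (∃ n : ℕ, t = -n ∧ (e ^ (n + 1)) v = 0 ∧
      ∃ B : Module.Basis (Fin (n + 1)) K V, ∀ i, B i = (e ^ (i : ℕ)) v) ∨
    ((∀ m : ℕ, t ≠ -m) ∧ ∃ B : Module.Basis ℕ K V, ∀ i, B i = (e ^ i) v) := by
  classical
  have hspan := T.span_pow_e_of_lowest S hv0 hv hf
  by_cases hex : ∃ k, (e ^ k) v = 0
  · left
    obtain ⟨n, hn⟩ : ∃ n, Nat.find hex = n + 1 :=
      Nat.exists_eq_succ_of_ne_zero fun h0 => hv0 (by simpa [h0] using Nat.find_spec hex)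
    have hzero : (e ^ (n + 1)) v = 0 := hn ▸ Nat.find_spec hex
    have hne : ∀ i, i < n + 1 → (e ^ i) v ≠ 0 := fun i hi => Nat.find_min hex (hn ▸ hi)
    refine ⟨n, ?_, hzero, ?_⟩
    -- Applying `f` to `e^(n+1) v = 0`, with `e^n v ≠ 0`, forces `(n+1)(t+n) = 0`.
    · have h1 := T.f_pow_e_lowest hv hf n
      rw [hzero, map_zero] at h1
      have h2 := (smul_eq_zero.1 h1.symm).resolve_right (hne n n.lt_succ_self)
      have h3 : ((n : K) + 1) ≠ 0 := Nat.cast_add_one_ne_zero n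
      exact eq_neg_of_add_eq_zero_left ((mul_eq_zero.1 (neg_eq_zero.1 h2)).resolve_left h3)
    · have hli := T.linearIndependent_pow_e hv (fun i : Fin (n + 1) => (i : ℕ))
        Fin.val_injective fun i => hne i i.2
      refine ⟨Module.Basis.mk hli ?_, fun i => Module.Basis.mk_apply hli _ i⟩
      rw [← hspan, Submodule.span_le]
      rintro _ ⟨k, rfl⟩
      by_cases hk : k < n + 1
      · exact Submodule.subset_span ⟨⟨k, hk⟩, rfl⟩
      · simp [pow_e_eq_zero_of_le hzero (not_lt.1 hk)]
  · right
    have hne : ∀ k, (e ^ k) v ≠ 0 := not_exists.1 hex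
    have hli := T.linearIndependent_pow_e hv id Function.injective_id hne
    refine ⟨?_, Module.Basis.mk hli hspan.ge, fun i => Module.Basis.mk_apply hli _ i⟩
    rintro m rfl
    -- If `t = -m`, then `e^(m+1) v` would be a second lowest weight vector; its powers of `e` would
    -- span `V` and yet miss `v`.
    have hf' : f ((e ^ (m + 1)) v) = 0 := by simp [T.f_pow_e_lowest hv hf m]
    have hspan' := T.span_pow_e_of_lowest S (hne (m + 1)) (T.h_pow_e hv (m + 1)) hf'
    refine hli.notMem_span_image (s := Set.Ici (m + 1)) (x := 0) (by simp) ?_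
    have hle : Submodule.span K (Set.range fun k : ℕ => (e ^ k) ((e ^ (m + 1)) v)) ≤
        Submodule.span K ((fun i => (e ^ id i) v) '' Set.Ici (m + 1)) := by
      refine Submodule.span_mono ?_
      rintro _ ⟨k, rfl⟩
      exact ⟨k + (m + 1), by simp, by simp [pow_add]⟩
    rw [hspan'] at hle
    exact hle Submodule.mem_top

/-- The images of `v` under the powers of `e` and of `f`, indexed by the integers. -/
def _root_.HomLie.ladder (e f : Module.End K V) (v : V) : ℤ → V
  | Int.ofNat k => (e ^ k) v
  | Int.negSucc k => (f ^ (k + 1)) v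

theorem _root_.HomLie.ladder_natCast (v : V) (k : ℕ) : ladder e f v k = (e ^ k) v := rfl

theorem _root_.HomLie.ladder_neg_natCast (v : V) (k : ℕ) : ladder e f v (-k) = (f ^ k) v := by
  cases k <;> rfl

theorem h_ladder (T : TwistedTriple l β e f h) {t : K} {v : V} (hv : h v = t • v) (i : ℤ) :
    h (ladder e f v i) = (t + 2 * i) • ladder e f v i := by
  rcases Int.eq_nat_or_neg i with ⟨k, rfl | rfl⟩
  · simpa [ladder_natCast] using T.h_pow_e hv k
  · have := T.dual.h_pow_e (t := -t) (v := v) (by simp [hv]) k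
    rw [LinearMap.neg_apply, neg_eq_iff_eq_neg, ← neg_smul] at this
    rw [ladder_neg_natCast, this]
    push_cast
    congr 1
    ring

theorem beta_ladder (T : TwistedTriple l β e f h) {b : K} {v : V} (hv : β v = b • v) (i : ℤ) :
    β (ladder e f v i) = ((l : K) ^ i * b) • ladder e f v i := by
  rcases Int.eq_nat_or_neg i with ⟨k, rfl | rfl⟩
  · simpa [ladder_natCast] using T.beta_pow_e hv k
  · simpa [ladder_neg_natCast, zpow_neg] using T.dual.beta_pow_e hv k

theorem _root_.HomLie.e_ladder_of_nonneg (v : V) {i : ℤ} (hi : 0 ≤ i) :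
    e (ladder e f v i) = ladder e f v (i + 1) := by
  lift i to ℕ using hi
  have : ((i : ℤ) + 1) = ((i + 1 : ℕ) : ℤ) := by push_cast; rfl
  rw [this, ladder_natCast, ladder_natCast, pow_succ', Module.End.mul_apply]

theorem _root_.HomLie.f_ladder_of_nonpos (v : V) {i : ℤ} (hi : i ≤ 0) :
    f (ladder e f v i) = ladder e f v (i - 1) := by
  obtain ⟨k, rfl⟩ : ∃ k : ℕ, i = -k := ⟨(-i).toNat, by omega⟩
  have : (-(k : ℤ) - 1) = -((k + 1 : ℕ) : ℤ) := by push_cast; ring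
  rw [this, ladder_neg_natCast, ladder_neg_natCast, pow_succ', Module.End.mul_apply]

/-- `4 c + (t+1)² - 1` is the value at `v` of the Casimir operator `4 f e + h² + 2 h`. With it the
coefficient takes the shape required by the intermediate series. -/
theorem f_ladder_of_pos [CharZero K] (T : TwistedTriple l β e f h) {t c : K} {v : V}
    (hv : h v = t • v) (hc : f (e v) = c • v) {i : ℤ} (hi : 0 < i) :
    f (ladder e f v i) =
      ((4 * c + (t + 1) ^ 2 - 1 - (t + 2 * i - 1) ^ 2 + 1) / 4) • ladder e f v (i - 1) := by
  obtain ⟨k, rfl⟩ : ∃ k : ℕ, i = (k + 1 : ℕ) := ⟨(i - 1).toNat, by omega⟩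
  have : (((k + 1 : ℕ) : ℤ) - 1) = k := by push_cast; ring
  rw [this, ladder_natCast, ladder_natCast, T.f_pow_e hv hc]
  push_cast
  congr 1
  field_simp
  ring

/-- The dual of the formula for `f e^(k+1) v`, started from `e f v = (c + t) v`; the same Casimir
value appears. -/
theorem e_ladder_of_neg [CharZero K] (T : TwistedTriple l β e f h) {t c : K} {v : V}
    (hv : h v = t • v) (hc : f (e v) = c • v) {i : ℤ} (hi : i < 0) :
    e (ladder e f v i) =
      ((4 * c + (t + 1) ^ 2 - 1 - (t + 2 * i + 1) ^ 2 + 1) / 4) • ladder e f v (i + 1) := by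
  obtain ⟨k, rfl⟩ : ∃ k : ℕ, i = -((k + 1 : ℕ) : ℤ) := ⟨(-i - 1).toNat, by omega⟩
  have : (-((k + 1 : ℕ) : ℤ) + 1) = -k := by push_cast; ring
  have hc' : e (f v) = (c + t) • v := by rw [T.ef, hc, hv, add_smul]
  rw [this, ladder_neg_natCast, ladder_neg_natCast,
    T.dual.f_pow_e (t := -t) (by simp [hv]) hc']
  push_cast
  congr 1
  field_simp
  ring

/-- In a simple twisted module without highest or lowest weight vectors, the ladder through a
weight vector is a basis. -/
theorem exists_basis_ladder [IsAlgClosed K] [CharZero K] (T : TwistedTriple l β e f h)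
    (S : IsTwistSimple β e f h) (he : ∀ (s : K) u, u ≠ 0 → h u = s • u → e u ≠ 0)
    (hf : ∀ (s : K) u, u ≠ 0 → h u = s • u → f u ≠ 0) {t : K} {v : V} (hv0 : v ≠ 0)
    (hv : h v = t • v) : ∃ B : Module.Basis ℤ K V, ∀ i, B i = ladder e f v i := by
  obtain ⟨b, c, -, -, -, hs⟩ := T.weightVector_generates S hv0 hv
  have he' : ∀ k : ℕ, (e ^ k) v ≠ 0 := by
    intro k
    induction k with
    | zero => simpa
    | succ k ih =>
      rw [pow_succ', Module.End.mul_apply]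
      exact he _ _ ih (T.h_pow_e hv k)
  have hf' : ∀ k : ℕ, (f ^ k) v ≠ 0 := by
    intro k
    induction k with
    | zero => simpa
    | succ k ih =>
      rw [pow_succ', Module.End.mul_apply]
      refine hf (t + 2 * ((-(k : ℤ) : ℤ) : K)) _ ih ?_
      rw [← ladder_neg_natCast (e := e)]
      exact T.h_ladder hv (-k)
  have hne : ∀ i, ladder e f v i ≠ 0 := by
    intro i
    rcases Int.eq_nat_or_neg i with ⟨k, rfl | rfl⟩
    · exact he' k
    · rw [ladder_neg_natCast]
      exact hf' k
  have hli : LinearIndependent K (ladder e f v) := by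
    refine Module.End.eigenvectors_linearIndependent' h (fun i : ℤ => t + 2 * (i : K)) ?_ _
      fun i => ⟨Module.End.mem_eigenspace_iff.2 (T.h_ladder hv i), hne i⟩
    intro i j hij
    have : (2 : K) * (i : K) = 2 * j := by linear_combination hij
    exact Int.cast_injective (mul_left_cancel₀ two_ne_zero this)
  refine ⟨Module.Basis.mk hli ?_, fun i => Module.Basis.mk_apply hli _ i⟩
  rw [← hs]
  refine sup_le (Submodule.span_mono ?_) (Submodule.span_mono ?_)
  · rintro _ ⟨k, rfl⟩
    exact ⟨k, rfl⟩
  · rintro _ ⟨k, rfl⟩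
    exact ⟨-k, ladder_neg_natCast v k⟩

end TwistedTriple

end Bases

/-! ### From Hom-representations to twisted triples and back -/

section Sl2

variable {K : Type*} [Field K]

theorem sl2_eq (X : Sl2 K) :
    X = X.1 0 1 • sl2E K + X.1 1 0 • sl2F K + X.1 0 0 • sl2H K := by
  have h := (mem_sl2_iff K _).1 X.2
  ext i j
  fin_cases i <;> fin_cases j <;> simp [sl2E, sl2F, sl2H]
  exact eq_neg_of_add_eq_zero_right h

theorem homSl2_twist_e (l : Kˣ) : (homSl2 l).twist (sl2E K) = (l : K) • sl2E K := diagTwist_e l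

theorem homSl2_twist_f (l : Kˣ) : (homSl2 l).twist (sl2F K) = (l : K)⁻¹ • sl2F K := diagTwist_f l

theorem homSl2_twist_h (l : Kˣ) : (homSl2 l).twist (sl2H K) = sl2H K := diagTwist_h l

theorem homSl2_bracket_ef (l : Kˣ) : (homSl2 l).bracket (sl2E K) (sl2F K) = sl2H K := by
  change diagTwist l ⁅sl2E K, sl2F K⁆ = _
  ext i j
  fin_cases i <;> fin_cases j <;>
    simp [diagTwist, sl2E, sl2F, sl2H, LieRing.of_associative_ring_bracket]

theorem homSl2_bracket_he (l : Kˣ) :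
    (homSl2 l).bracket (sl2H K) (sl2E K) = (2 * l : K) • sl2E K := by
  change diagTwist l ⁅sl2H K, sl2E K⁆ = _
  ext i j
  fin_cases i <;> fin_cases j <;>
    simp [diagTwist, sl2E, sl2H, LieRing.of_associative_ring_bracket]
  ring

theorem homSl2_bracket_hf (l : Kˣ) :
    (homSl2 l).bracket (sl2H K) (sl2F K) = (-2 * (l : K)⁻¹) • sl2F K := by
  change diagTwist l ⁅sl2H K, sl2F K⁆ = _
  ext i j
  fin_cases i <;> fin_cases j <;>
    simp [diagTwist, sl2F, sl2H, LieRing.of_associative_ring_bracket]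
  ring

end Sl2

namespace HomRep

section Relations

variable {K V : Type*} [Field K] [AddCommGroup V] [Module K V] {l : Kˣ}
  (M : HomRep (homSl2 l) V)

theorem beta_action_e (v : V) :
    M.beta (M.action (sl2E K) v) = (l : K) • M.action (sl2E K) (M.beta v) := by
  have := LinearMap.congr_fun (M.action_twist (sl2E K)) v
  rw [homSl2_twist_e, map_smul] at this
  exact this.symm

theorem beta_action_f (v : V) :
    M.beta (M.action (sl2F K) v) = (l : K)⁻¹ • M.action (sl2F K) (M.beta v) := by
  have := LinearMap.congr_fun (M.action_twist (sl2F K)) v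
  rw [homSl2_twist_f, map_smul] at this
  exact this.symm

theorem beta_action_h (v : V) :
    M.beta (M.action (sl2H K) v) = M.action (sl2H K) (M.beta v) := by
  have := LinearMap.congr_fun (M.action_twist (sl2H K)) v
  rw [homSl2_twist_h] at this
  exact this.symm

theorem action_ef (v : V) :
    M.action (sl2H K) (M.beta v) = (l : K) • M.action (sl2E K) (M.action (sl2F K) v) -
      (l : K)⁻¹ • M.action (sl2F K) (M.action (sl2E K) v) := by
  have := LinearMap.congr_fun (M.action_bracket (sl2E K) (sl2F K)) v
  rw [homSl2_bracket_ef, homSl2_twist_e, homSl2_twist_f, map_smul, map_smul] at this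
  exact this

theorem action_he (v : V) :
    (2 * l : K) • M.action (sl2E K) (M.beta v) = M.action (sl2H K) (M.action (sl2E K) v) -
      (l : K) • M.action (sl2E K) (M.action (sl2H K) v) := by
  have := LinearMap.congr_fun (M.action_bracket (sl2H K) (sl2E K)) v
  rw [homSl2_bracket_he, homSl2_twist_e, homSl2_twist_h, map_smul, map_smul] at this
  exact this

theorem action_hf (v : V) :
    (-2 * (l : K)⁻¹) • M.action (sl2F K) (M.beta v) = M.action (sl2H K) (M.action (sl2F K) v) -
      (l : K)⁻¹ • M.action (sl2F K) (M.action (sl2H K) v) := by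
  have := LinearMap.congr_fun (M.action_bracket (sl2H K) (sl2F K)) v
  rw [homSl2_bracket_hf, homSl2_twist_f, homSl2_twist_h, map_smul, map_smul] at this
  exact this

variable {M} in
theorem beta_inducedAction (hM : IsUnit M.beta) (x : Sl2 K) (v : V) :
    M.beta (M.inducedAction x v) = M.action x v := by
  have : M.beta * M.inducedAction x = M.action x := by
    rw [inducedAction, ← mul_assoc, Ring.mul_inverse_cancel _ hM, one_mul]
  exact LinearMap.congr_fun this v

variable {M} in
theorem inducedAction_eq_iff (hM : IsUnit M.beta) (x : Sl2 K) (v w : V) :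
    M.inducedAction x v = w ↔ M.action x v = M.beta w := by
  rw [← beta_inducedAction hM]
  exact (((Module.End.isUnit_iff _).1 hM).1.eq_iff).symm

variable {M} in
theorem twistedTriple (hM : IsUnit M.beta) :
    TwistedTriple l M.beta (M.inducedAction (sl2E K)) (M.inducedAction (sl2F K))
      (M.inducedAction (sl2H K)) := by
  have hinj : Function.Injective M.beta := ((Module.End.isUnit_iff _).1 hM).1
  have hl : (l : K) ≠ 0 := l.ne_zero
  -- One application of `β` clears `β⁻¹` from the intertwining relations; the bracket relations,
  -- quadratic in the action, need two.
  refine ⟨hinj, fun v => hinj ?_, fun v => hinj ?_, fun v => hinj ?_, fun v => hinj (hinj ?_),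
    fun v => hinj (hinj ?_), fun v => hinj (hinj ?_)⟩ <;>
    simp only [map_add, map_sub, map_smul, beta_inducedAction hM, beta_action_e, beta_action_f,
      beta_action_h, action_ef]
  · linear_combination (norm := module) -(1 : K) • M.action_he v
  · linear_combination (norm := module) -(1 : K) • M.action_hf v
  · module

end Relations

section Construction

variable {K V : Type*} [Field K] [AddCommGroup V] [Module K V] {l : Kˣ}

/-- The relations of the actions of `e, f, h` and of `β` in a representation of the diagonally
twisted Hom-`sl(2)`. -/
structure Sl2Relations (l : Kˣ) (β E F H : Module.End K V) : Prop where
  beta_e : ∀ v, β (E v) = (l : K) • E (β v)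
  beta_f : ∀ v, β (F v) = (l : K)⁻¹ • F (β v)
  beta_h : ∀ v, β (H v) = H (β v)
  ef : ∀ v, H (β v) = (l : K) • E (F v) - (l : K)⁻¹ • F (E v)
  he : ∀ v, (2 * l : K) • E (β v) = H (E v) - (l : K) • E (H v)
  hf : ∀ v, (-2 * (l : K)⁻¹) • F (β v) = H (F v) - (l : K)⁻¹ • F (H v)

theorem Sl2Relations.dual {β E F H : Module.End K V} (R : Sl2Relations l⁻¹ β E F H) :
    Sl2Relations l β F E (-H) where
  beta_e v := by simpa using R.beta_f v
  beta_f v := by simpa using R.beta_e v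
  beta_h v := by simpa using R.beta_h v
  ef v := by
    have := R.ef v
    rw [Units.val_inv_eq_inv_val, inv_inv] at this
    rw [LinearMap.neg_apply, this, neg_sub]
  he v := by
    have := R.hf v
    rw [Units.val_inv_eq_inv_val, inv_inv] at this
    simp only [LinearMap.neg_apply, map_neg]
    linear_combination (norm := module) -(1 : K) • this
  hf v := by
    have := R.he v
    rw [Units.val_inv_eq_inv_val] at this
    simp only [LinearMap.neg_apply, map_neg]
    linear_combination (norm := module) -(1 : K) • this

/-- A spanning family suffices, not necessarily a basis; this admits a family that becomes zero from
some index on. -/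
theorem Sl2Relations.of_span {ι : Type*} {v : ι → V} (hv : Submodule.span K (Set.range v) = ⊤)
    {β E F H : Module.End K V} (hE : ∀ i, β (E (v i)) = (l : K) • E (β (v i)))
    (hF : ∀ i, β (F (v i)) = (l : K)⁻¹ • F (β (v i))) (hH : ∀ i, β (H (v i)) = H (β (v i)))
    (hEF : ∀ i, H (β (v i)) = (l : K) • E (F (v i)) - (l : K)⁻¹ • F (E (v i)))
    (hHE : ∀ i, (2 * l : K) • E (β (v i)) = H (E (v i)) - (l : K) • E (H (v i)))
    (hHF : ∀ i, (-2 * (l : K)⁻¹) • F (β (v i)) = H (F (v i)) - (l : K)⁻¹ • F (H (v i))) :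
    Sl2Relations l β E F H where
  beta_e := LinearMap.congr_fun (f := β * E) (g := (l : K) • (E * β)) (LinearMap.ext_on_range hv hE)
  beta_f := LinearMap.congr_fun (f := β * F) (g := (l : K)⁻¹ • (F * β))
    (LinearMap.ext_on_range hv hF)
  beta_h := LinearMap.congr_fun (f := β * H) (g := H * β) (LinearMap.ext_on_range hv hH)
  ef := LinearMap.congr_fun (f := H * β) (g := (l : K) • (E * F) - (l : K)⁻¹ • (F * E))
    (LinearMap.ext_on_range hv hEF)
  he := LinearMap.congr_fun (f := (2 * l : K) • (E * β)) (g := H * E - (l : K) • (E * H))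
    (LinearMap.ext_on_range hv hHE)
  hf := LinearMap.congr_fun (f := (-2 * (l : K)⁻¹) • (F * β)) (g := H * F - (l : K)⁻¹ • (F * H))
    (LinearMap.ext_on_range hv hHF)

/-- The representation of the diagonally twisted Hom-`sl(2)` in which `e, f, h` act by `E, F, H`. -/
def ofSl2 (β E F H : Module.End K V) (R : Sl2Relations l β E F H) :
    HomRep (homSl2 l) V where
  action :=
    { toFun X := X.1 0 1 • E + X.1 1 0 • F + X.1 0 0 • H
      map_add' X Y := by simp; module
      map_smul' c X := by simp [smul_smul] }
  beta := β
  action_twist X := by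
    ext v
    change ((l * X.1 0 1) • E + ((l⁻¹ : Kˣ) * X.1 1 0) • F + X.1 0 0 • H) (β v) =
      β ((X.1 0 1 • E + X.1 1 0 • F + X.1 0 0 • H) v)
    simp only [LinearMap.add_apply, LinearMap.smul_apply, map_add, map_smul, R.beta_e, R.beta_f, R.beta_h,
      Units.val_inv_eq_inv_val]
    module
  action_bracket X Y := by
    ext v
    have hX := eq_neg_of_add_eq_zero_right ((mem_sl2_iff K _).1 X.2)
    have hY := eq_neg_of_add_eq_zero_right ((mem_sl2_iff K _).1 Y.2)
    have h01 : (⁅X, Y⁆ : Sl2 K).1 0 1 = 2 * (X.1 0 0 * Y.1 0 1 - X.1 0 1 * Y.1 0 0) := by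
      simp [LieRing.of_associative_ring_bracket, Matrix.mul_apply, hX, hY]
      ring
    have h10 : (⁅X, Y⁆ : Sl2 K).1 1 0 = 2 * (X.1 1 0 * Y.1 0 0 - X.1 0 0 * Y.1 1 0) := by
      simp [LieRing.of_associative_ring_bracket, Matrix.mul_apply, hX, hY]
      ring
    have h00 : (⁅X, Y⁆ : Sl2 K).1 0 0 = X.1 0 1 * Y.1 1 0 - X.1 1 0 * Y.1 0 1 := by
      simp [LieRing.of_associative_ring_bracket, Matrix.mul_apply]
      ring
    change ((l * (⁅X, Y⁆ : Sl2 K).1 0 1) • E + ((l⁻¹ : Kˣ) * (⁅X, Y⁆ : Sl2 K).1 1 0) • F +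
        (⁅X, Y⁆ : Sl2 K).1 0 0 • H) (β v) =
      ((l * X.1 0 1) • E + ((l⁻¹ : Kˣ) * X.1 1 0) • F + X.1 0 0 • H)
          ((Y.1 0 1 • E + Y.1 1 0 • F + Y.1 0 0 • H) v) -
        ((l * Y.1 0 1) • E + ((l⁻¹ : Kˣ) * Y.1 1 0) • F + Y.1 0 0 • H)
          ((X.1 0 1 • E + X.1 1 0 • F + X.1 0 0 • H) v)
    rw [h01, h10, h00]
    simp only [LinearMap.add_apply, LinearMap.smul_apply, map_add, map_smul,
      Units.val_inv_eq_inv_val]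
    -- By bilinearity, the weights are the coefficients of `[e, f]`, `[h, e]` and `[h, f]` in `[X,
    -- Y]`.
    linear_combination (norm := module) (X.1 0 1 * Y.1 1 0 - X.1 1 0 * Y.1 0 1) • R.ef v +
      (X.1 0 0 * Y.1 0 1 - X.1 0 1 * Y.1 0 0) • R.he v +
      (X.1 0 0 * Y.1 1 0 - X.1 1 0 * Y.1 0 0) • R.hf v

theorem ofSl2_e {β E F H : Module.End K V} (R : Sl2Relations l β E F H) :
    (ofSl2 β E F H R).action (sl2E K) = E := by
  change (sl2E K).1 0 1 • E + (sl2E K).1 1 0 • F + (sl2E K).1 0 0 • H = E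
  simp [sl2E]

theorem ofSl2_f {β E F H : Module.End K V} (R : Sl2Relations l β E F H) :
    (ofSl2 β E F H R).action (sl2F K) = F := by
  change (sl2F K).1 0 1 • E + (sl2F K).1 1 0 • F + (sl2F K).1 0 0 • H = F
  simp [sl2F]

theorem ofSl2_h {β E F H : Module.End K V} (R : Sl2Relations l β E F H) :
    (ofSl2 β E F H R).action (sl2H K) = H := by
  change (sl2H K).1 0 1 • E + (sl2H K).1 1 0 • F + (sl2H K).1 0 0 • H = H
  simp [sl2H]

end Construction

variable {K V : Type*} [Field K] [AddCommGroup V] [Module K V] {l : Kˣ}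

theorem isSubrep_of_mem {M : HomRep (homSl2 l) V} {W : Submodule K V}
    (hβ : ∀ w ∈ W, M.beta w ∈ W) (hE : ∀ w ∈ W, M.action (sl2E K) w ∈ W)
    (hF : ∀ w ∈ W, M.action (sl2F K) w ∈ W) (hH : ∀ w ∈ W, M.action (sl2H K) w ∈ W) :
    M.IsSubrep W := by
  refine ⟨fun x w hw => ?_, hβ⟩
  rw [sl2_eq x]
  simp only [map_add, map_smul, LinearMap.add_apply, LinearMap.smul_apply]
  exact W.add_mem (W.add_mem (W.smul_mem _ (hE w hw)) (W.smul_mem _ (hF w hw)))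
    (W.smul_mem _ (hH w hw))

theorem IsIrreducible.isTwistSimple {M : HomRep (homSl2 l) V} (hI : M.IsIrreducible)
    (hM : IsUnit M.beta) :
    IsTwistSimple M.beta (M.inducedAction (sl2E K)) (M.inducedAction (sl2F K))
      (M.inducedAction (sl2H K)) := by
  intro W hW
  refine hI.2 W (isSubrep_of_mem hW.beta_mem (fun w hw => ?_) (fun w hw => ?_) fun w hw => ?_)
  · simpa [beta_inducedAction hM] using hW.e_mem w hw
  · simpa [beta_inducedAction hM] using hW.f_mem w hw
  · simpa [beta_inducedAction hM] using hW.h_mem w hw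

theorem exists_mem_weightSpace_iff {M : HomRep (homSl2 l) V} (v : V) :
    (∃ χ, v ∈ M.weightSpace (sl2Cartan K) χ) ↔ ∃ t : K, M.inducedAction (sl2H K) v = t • v := by
  simp only [weightSpace, Submodule.mem_iInf, Module.End.mem_eigenspace_iff]
  constructor
  · rintro ⟨χ, hχ⟩
    exact ⟨_, hχ ⟨sl2H K, Submodule.mem_span_singleton_self _⟩⟩
  · rintro ⟨t, ht⟩
    -- The upper left entry is the functional on the Cartan subalgebra with value `1` at `h`.
    refine ⟨t • ((Matrix.entryLinearMap K K (0 : Fin 2) (0 : Fin 2)).comp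
      (Submodule.subtype _)).comp (Submodule.subtype (sl2Cartan K)), ?_⟩
    rintro ⟨x, hx⟩
    obtain ⟨c, rfl⟩ := Submodule.mem_span_singleton.1 hx
    have h1 : M.inducedAction (c • sl2H K) v = c • M.inducedAction (sl2H K) v := by
      simp [inducedAction]
    have h2 : (sl2H K).1 0 0 = 1 := by simp [sl2H]
    rw [h1, ht, smul_smul]
    congr 1
    change c * t = t * (c • (sl2H K).1) 0 0
    rw [Matrix.smul_apply, h2, smul_eq_mul, mul_one, mul_comm]

end HomRep

/-! ### Irreducible weight modules are of one of the four types -/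

section Classification

variable {K V : Type*} [Field K] [AddCommGroup V] [Module K V] {l : Kˣ}
  {M : HomRep (homSl2 l) V}

theorem HomRep.IsWeightModule.exists_weightVector [Nontrivial V]
    (hW : M.IsWeightModule (sl2Cartan K)) :
    ∃ v ≠ 0, ∃ t : K, M.inducedAction (sl2H K) v = t • v := by
  by_contra! hcon
  obtain ⟨m, hm⟩ := exists_ne (0 : V)
  have h0 : ∀ χ, M.weightSpace (sl2Cartan K) χ = ⊥ := by
    intro χ
    rw [Submodule.eq_bot_iff]
    intro v hv
    by_contra hv0
    obtain ⟨t, ht⟩ := (HomRep.exists_mem_weightSpace_iff v).1 ⟨χ, hv⟩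
    exact hcon v hv0 t ht
  have h1 := hW.2
  rw [iSup_congr h0, iSup_bot] at h1
  exact hm ((Submodule.mem_bot K).1 (h1 ▸ Submodule.mem_top))

theorem isLowestWeightVector_iff (hM : IsUnit M.beta) (v : V) :
    IsLowestWeightVector M v ↔ v ≠ 0 ∧ (∃ t : K, M.inducedAction (sl2H K) v = t • v) ∧
      M.inducedAction (sl2F K) v = 0 := by
  rw [IsLowestWeightVector, HomRep.exists_mem_weightSpace_iff, HomRep.inducedAction_eq_iff hM,
    map_zero]

theorem isHighestWeightVector_iff (hM : IsUnit M.beta) (v : V) :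
    IsHighestWeightVector M v ↔ v ≠ 0 ∧ (∃ t : K, M.inducedAction (sl2H K) v = t • v) ∧
      M.inducedAction (sl2E K) v = 0 := by
  rw [IsHighestWeightVector, HomRep.exists_mem_weightSpace_iff, HomRep.inducedAction_eq_iff hM,
    map_zero]

variable [IsAlgClosed K] [CharZero K]

theorem isFiniteType_or_isLowestType (hI : M.IsIrreducible) (hM : IsUnit M.beta)
    (hv : ∃ v, IsLowestWeightVector M v) : IsFiniteType M ∨ IsLowestType M := by
  obtain ⟨v, hv⟩ := hv
  obtain ⟨hv0, ⟨t, ht⟩, hf⟩ := (isLowestWeightVector_iff hM v).1 hv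
  have T := HomRep.twistedTriple hM
  have S := hI.isTwistSimple hM
  obtain ⟨b, -, hb, hbv, -, -⟩ := T.weightVector_generates S hv0 ht
  have hβ := T.beta_pow_e hbv
  have hh := T.h_pow_e ht
  have hfe := T.f_pow_e_lowest ht hf
  have hx := HomRep.beta_inducedAction hM
  set e := M.inducedAction (sl2E K) with he
  rcases T.exists_basis_of_lowest S hv0 ht hf with ⟨n, rfl, hn, B, hB⟩ | ⟨ht', B, hB⟩
  · left
    refine ⟨n, b, hb, B, fun i => ?_, fun i => ?_, ?_, fun i => ?_, ?_, fun i => ?_⟩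
    · rw [hB, ← hx, hh, map_smul, hβ, smul_smul]
      congr 1
      ring
    · rw [hB, hB, ← hx, ← he, ← Module.End.mul_apply e, ← pow_succ', hβ]
      rfl
    · rw [hB, ← hx, ← he, ← Module.End.mul_apply e, ← pow_succ', Fin.val_last, hn, map_zero]
    · rw [hB, hB, ← hx, Fin.val_succ, hfe, map_smul, hβ, smul_smul]
      congr 1
      ring
    · rw [hB, ← hx]
      simp [hf]
    · rw [hB, hβ]
  · right
    refine ⟨t, b, hb, ht', B, fun i => ?_, fun i => ?_, fun i => ?_, ?_, fun i => ?_⟩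
    · rw [hB, ← hx, hh, map_smul, hβ, smul_smul]
      congr 1
      ring
    · rw [hB, hB, ← hx, ← he, ← Module.End.mul_apply e, ← pow_succ', hβ]
    · rw [hB, hB, ← hx, hfe, map_smul, hβ, smul_smul]
      congr 1
      ring
    · rw [hB, ← hx]
      simp [hf]
    · rw [hB, hβ]

/-- The lowest weight argument for the dual triple. Its finite alternative is ruled out, since there
the last basis vector would be a lowest weight vector. -/
theorem isHighestType_of_exists (hI : M.IsIrreducible) (hM : IsUnit M.beta)
    (hlow : ¬∃ v, IsLowestWeightVector M v) (hv : ∃ v, IsHighestWeightVector M v) :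
    IsHighestType M := by
  obtain ⟨v, hv⟩ := hv
  obtain ⟨hv0, ⟨t, ht⟩, he⟩ := (isHighestWeightVector_iff hM v).1 hv
  have T := (HomRep.twistedTriple hM).dual
  have S := (hI.isTwistSimple hM).dual
  have ht' : (-M.inducedAction (sl2H K)) v = (-t) • v := by simp [ht]
  obtain ⟨b, -, hb, hbv, -, -⟩ := T.weightVector_generates S hv0 ht'
  have hβ := T.beta_pow_e hbv
  have hh := T.h_pow_e ht'
  have hef := T.f_pow_e_lowest ht' he
  have hh' : ∀ k : ℕ, M.inducedAction (sl2H K) ((M.inducedAction (sl2F K) ^ k) v) =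
      (t - 2 * k) • (M.inducedAction (sl2F K) ^ k) v := by
    intro k
    have := hh k
    rw [LinearMap.neg_apply, neg_eq_iff_eq_neg, ← neg_smul] at this
    rw [this]
    congr 1
    ring
  have hx := HomRep.beta_inducedAction hM
  set f := M.inducedAction (sl2F K) with hf
  rcases T.exists_basis_of_lowest S hv0 ht' he with ⟨n, -, hn, B, hB⟩ | ⟨htm, B, hB⟩
  · refine absurd ⟨(f ^ n) v, (isLowestWeightVector_iff hM _).2 ⟨?_, ⟨_, hh' n⟩, ?_⟩⟩ hlow
    · have := B.ne_zero (Fin.last n)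
      rwa [hB] at this
    · rw [← hf, ← Module.End.mul_apply f, ← pow_succ', hn]
  · refine ⟨t, b, hb, fun m hm => htm m (by rw [hm]), B, fun i => ?_, fun i => ?_, fun i => ?_, ?_,
      fun i => ?_⟩
    · rw [hB, ← hx, hh', map_smul, hβ, smul_smul]
      congr 1
      simp
      ring
    · rw [hB, hB, ← hx, ← hf, ← Module.End.mul_apply f, ← pow_succ', hβ]
      congr 1
      rw [show (-(i : ℤ) - 1) = -((i + 1 : ℕ) : ℤ) by push_cast; ring, zpow_neg,
        zpow_natCast]
      simp
    · rw [hB, hB, ← hx, hef, map_smul, hβ, smul_smul]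
      congr 1
      simp
      ring
    · rw [hB, ← hx]
      simp [he]
    · rw [hB, hβ]
      simp

theorem isIntermediateType_of_not_exists (hI : M.IsIrreducible)
    (hW : M.IsWeightModule (sl2Cartan K)) (hlow : ¬∃ v, IsLowestWeightVector M v)
    (hhigh : ¬∃ v, IsHighestWeightVector M v) : IsIntermediateType M := by
  have := hI.1
  obtain ⟨v, hv0, t, ht⟩ := hW.exists_weightVector
  have hM := hW.1
  have T := HomRep.twistedTriple hM
  have S := hI.isTwistSimple hM
  obtain ⟨b, c, hb, hbv, hc, -⟩ := T.weightVector_generates S hv0 ht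
  obtain ⟨B, hB⟩ := T.exists_basis_ladder S
    (fun s u hu hs h0 => hhigh ⟨u, (isHighestWeightVector_iff hM u).2 ⟨hu, ⟨s, hs⟩, h0⟩⟩)
    (fun s u hu hs h0 => hlow ⟨u, (isLowestWeightVector_iff hM u).2 ⟨hu, ⟨s, hs⟩, h0⟩⟩) hv0 ht
  have hβ := T.beta_ladder hbv
  have hh := T.h_ladder ht
  have hfpos := fun i hi => T.f_ladder_of_pos ht hc (i := i) hi
  have heneg := fun i hi => T.e_ladder_of_neg ht hc (i := i) hi
  have hx := HomRep.beta_inducedAction hM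
  -- `μ` is the Casimir value.
  refine ⟨t, 4 * c + (t + 1) ^ 2 - 1, b, hb, fun i hi => ?_, B, fun i => ?_, fun i hi => ?_,
    fun i hi => ?_, fun i hi => ?_, fun i hi => ?_, fun i => ?_⟩
  -- A forbidden equality makes a ladder coefficient vanish between `v_i` and `v_(i+1)`: for `i <
  -- 0`, `e` kills `v_i`; for `i ≥ 0`, `f` kills `v_(i+1)`.
  · rcases lt_or_ge i 0 with hi0 | hi0
    · refine hhigh ⟨B i, (isHighestWeightVector_iff hM _).2 ⟨B.ne_zero i, ⟨_, hB i ▸ hh i⟩, ?_⟩⟩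
      rw [hB, heneg i hi0]
      convert zero_smul K _
      linear_combination -hi / 4
    · refine hlow ⟨B (i + 1), (isLowestWeightVector_iff hM _).2
        ⟨B.ne_zero _, ⟨_, hB (i + 1) ▸ hh (i + 1)⟩, ?_⟩⟩
      rw [hB, hfpos (i + 1) (by omega)]
      convert zero_smul K _
      push_cast
      linear_combination -hi / 4
  · rw [hB, ← hx, hh, map_smul, hβ, smul_smul]
    congr 1
    ring
  · rw [hB, hB, ← hx, e_ladder_of_nonneg v hi, hβ]
  · rw [hB, hB, ← hx, f_ladder_of_nonpos v hi, hβ]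
  · rw [hB, hB, ← hx, heneg i hi, map_smul, hβ, smul_smul]
    congr 1
    ring
  · rw [hB, hB, ← hx, hfpos i hi, map_smul, hβ, smul_smul]
    congr 1
    ring
  · rw [hB, hβ]

theorem isType_of_isIrreducible (hI : M.IsIrreducible) (hW : M.IsWeightModule (sl2Cartan K)) :
    IsFiniteType M ∨ IsLowestType M ∨ IsHighestType M ∨ IsIntermediateType M := by
  by_cases hlow : ∃ v, IsLowestWeightVector M v
  · exact (isFiniteType_or_isLowestType hI hW.1 hlow).imp_right Or.inl
  · by_cases hhigh : ∃ v, IsHighestWeightVector M v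
    · exact Or.inr (Or.inr (Or.inl (isHighestType_of_exists hI hW.1 hlow hhigh)))
    · exact Or.inr (Or.inr (Or.inr (isIntermediateType_of_not_exists hI hW hlow hhigh)))

end Classification

/-! ### Irreducibility read off from a basis of weight vectors -/

section Basis

variable {K V : Type*} [Field K] [AddCommGroup V] [Module K V] {ι : Type*}

/-- Used with the identity for `β` and `h`, and with translations of the index for `e` and `f`. -/
theorem basis_repr_shift (B : Module.Basis ι K V) {A : Module.End K V} {s : ι → ι}
    (hs : Function.Injective s) {a : ι → K} (hA : ∀ i, A (B i) = a i • B (s i)) (w : V) (i : ι) :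
    B.repr (A w) (s i) = a i * B.repr w i := by
  classical
  have : (Finsupp.lapply (s i) : (ι →₀ K) →ₗ[K] K) ∘ₗ B.repr.toLinearMap ∘ₗ A =
      a i • ((Finsupp.lapply i : (ι →₀ K) →ₗ[K] K) ∘ₗ B.repr.toLinearMap) := by
    refine B.ext fun j => ?_
    by_cases hj : j = i
    · subst hj
      simp [hA]
    · simp [hA, hs.eq_iff, hj]
  exact LinearMap.congr_fun this w

/-- This excludes highest weight vectors when `e` shifts the basis with nonzero coefficients, and
lowest ones when `f` does. -/
theorem injective_of_basis_shift (B : Module.Basis ι K V) {A : Module.End K V} {s : ι → ι}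
    (hs : Function.Injective s) (hA : ∀ i, ∃ a : K, a ≠ 0 ∧ A (B i) = a • B (s i)) :
    Function.Injective A := by
  choose a ha hA using hA
  rw [injective_iff_map_eq_zero]
  intro w hw
  refine B.ext_elem fun i => ?_
  have := basis_repr_shift B hs hA w i
  rw [hw] at this
  simpa [ha i] using this.symm

variable {l : Kˣ} {M : HomRep (homSl2 l) V}

/-- A nonzero subrepresentation of a module with a basis of weight vectors of distinct weights
contains a basis vector. -/
theorem exists_basis_mem (B : Module.Basis ι K V) {c d : ι → K}
    (hβ : ∀ i, M.beta (B i) = c i • B i) (hH : ∀ i, M.action (sl2H K) (B i) = (c i * d i) • B i)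
    (hc : ∀ i, c i ≠ 0) (hd : Function.Injective d) {W : Submodule K V} (hW : M.IsSubrep W)
    (hW0 : W ≠ ⊥) : ∃ i, B i ∈ W := by
  classical
  -- `A - a i` removes `i` from the support of `w`, keeps `j` and adds nothing.
  have key : ∀ (A : Module.End K V) (a : ι → K), (∀ i, A (B i) = a i • B i) →
      (∀ w ∈ W, A w ∈ W) → ∀ w ∈ W, ∀ i ∈ (B.repr w).support, ∀ j ∈ (B.repr w).support,
      a i ≠ a j → ∃ w' ∈ W, w' ≠ 0 ∧ (B.repr w').support.card < (B.repr w).support.card := by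
    intro A a hA hAW w hw i hi j hj hij
    have hrepr : ∀ k, B.repr (A w - a i • w) k = (a k - a i) * B.repr w k := by
      intro k
      rw [map_sub, map_smul, Finsupp.sub_apply, Finsupp.smul_apply, smul_eq_mul,
        show B.repr (A w) k = a k * B.repr w k from
          basis_repr_shift B Function.injective_id hA w k]
      ring
    refine ⟨A w - a i • w, W.sub_mem (hAW w hw) (W.smul_mem _ hw), fun h0 => ?_,
      Finset.card_lt_card ?_⟩
    · have h1 := hrepr j
      rw [h0] at h1
      simp only [map_zero, Finsupp.coe_zero, Pi.zero_apply] at h1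
      rcases mul_eq_zero.1 h1.symm with h2 | h2
      · exact hij (sub_eq_zero.1 h2).symm
      · exact Finsupp.mem_support_iff.1 hj h2
    · rw [Finset.ssubset_iff_of_subset]
      · exact ⟨i, hi, by rw [Finsupp.notMem_support_iff, hrepr, sub_self, zero_mul]⟩
      · intro k hk
        rw [Finsupp.mem_support_iff, hrepr] at hk
        exact Finsupp.mem_support_iff.2 (right_ne_zero_of_mul hk)
  have main : ∀ n : ℕ, ∀ w ∈ W, w ≠ 0 → (B.repr w).support.card = n → ∃ i, B i ∈ W := by
    intro n
    induction n using Nat.strong_induction_on with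
    | _ n ih =>
      intro w hw hw0 hn
      obtain ⟨i, hi⟩ : (B.repr w).support.Nonempty := by simpa using hw0
      by_cases hone : ∀ j ∈ (B.repr w).support, j = i
      · refine ⟨i, ?_⟩
        have h1 : B.repr w = Finsupp.single i (B.repr w i) := by
          ext j
          by_cases hj : j = i
          · subst hj
            simp
          · rw [Finsupp.single_eq_of_ne hj]
            by_contra hne
            exact hj (hone j (Finsupp.mem_support_iff.2 hne))
        have h2 : w = B.repr w i • B i := by
          rw [← B.repr_symm_single, ← h1, B.repr.symm_apply_apply]
        rw [h2] at hw
        exact (W.smul_mem_iff (Finsupp.mem_support_iff.1 hi)).1 hw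
      · push Not at hone
        obtain ⟨j, hj, hji⟩ := hone
        obtain ⟨w', hw', hw0', hlt⟩ : ∃ w' ∈ W, w' ≠ 0 ∧
            (B.repr w').support.card < (B.repr w).support.card := by
          -- Neither `β` nor the action of `h` need have distinct eigenvalues (`l` may be a root of
          -- unity), but together they separate indices: if `c i = c j`, then `c i * d i` and `c j *
          -- d j` differ. This avoids `β⁻¹`, under which `W` is not known to be stable.
          by_cases hcij : c i = c j
          · refine key _ (fun i => c i * d i) hH (hW.1 _) w hw i hi j hj fun h => hji ?_
            rw [hcij] at h
            exact (hd (mul_left_cancel₀ (hc j) h)).symm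
          · exact key _ c hβ hW.2 w hw i hi j hj hcij
        exact ih _ (hn ▸ hlt) w' hw' hw0' rfl
  obtain ⟨w, hw, hw0⟩ := W.ne_bot_iff.1 hW0
  exact main _ w hw hw0 rfl

theorem isWeightModule_of_basis (B : Module.Basis ι K V) {c d : ι → K}
    (hβ : ∀ i, M.beta (B i) = c i • B i) (hH : ∀ i, M.action (sl2H K) (B i) = (c i * d i) • B i)
    (hc : ∀ i, c i ≠ 0) : M.IsWeightModule (sl2Cartan K) ∧
      ∀ i, ∃ χ, B i ∈ M.weightSpace (sl2Cartan K) χ := by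
  have hM : IsUnit M.beta := by
    refine ⟨⟨M.beta, B.constr K fun i => (c i)⁻¹ • B i, B.ext fun i => ?_, B.ext fun i => ?_⟩, rfl⟩
    · simp [hβ, hc]
    · simp [hβ, hc]
  have hmem : ∀ i, ∃ χ, B i ∈ M.weightSpace (sl2Cartan K) χ := fun i =>
    (HomRep.exists_mem_weightSpace_iff _).2 ⟨d i, (HomRep.inducedAction_eq_iff hM _ _ _).2 (by
      rw [hH, map_smul, hβ, smul_smul, mul_comm])⟩
  refine ⟨⟨hM, ?_⟩, hmem⟩
  rw [eq_top_iff, ← B.span_eq, Submodule.span_le]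
  rintro _ ⟨i, rfl⟩
  obtain ⟨χ, hχ⟩ := hmem i
  exact Submodule.mem_iSup_of_mem χ hχ

theorem isIrreducible_of_basis [Nonempty ι] (B : Module.Basis ι K V) {c d : ι → K}
    (hβ : ∀ i, M.beta (B i) = c i • B i) (hH : ∀ i, M.action (sl2H K) (B i) = (c i * d i) • B i)
    (hc : ∀ i, c i ≠ 0) (hd : Function.Injective d)
    (hB : ∀ W, M.IsSubrep W → ∀ i j, B i ∈ W → B j ∈ W) : M.IsIrreducible := by
  refine ⟨⟨B (Classical.arbitrary ι), 0, B.ne_zero _⟩, fun W hW => or_iff_not_imp_left.2 fun h0 => ?_⟩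
  obtain ⟨i, hi⟩ := exists_basis_mem B hβ hH hc hd hW h0
  rw [eq_top_iff, ← B.span_eq, Submodule.span_le]
  rintro _ ⟨j, rfl⟩
  exact hB W hW i j hi

theorem HomRep.IsSubrep.mem_of_action_eq {W : Submodule K V} (hW : M.IsSubrep W) {x : Sl2 K}
    {a : K} {v w : V} (h : M.action x v = a • w) (ha : a ≠ 0) (hv : v ∈ W) : w ∈ W :=
  (W.smul_mem_iff ha).1 (h ▸ hW.1 x v hv)

end Basis

/-! ### Each type is irreducible, and its distinguishing properties -/

section Types

variable {K V : Type*} [Field K] [CharZero K] [AddCommGroup V] [Module K V] {l : Kˣ}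
  {M : HomRep (homSl2 l) V}

theorem IsFiniteType.isIrreducible_and (hM : IsFiniteType M) :
    (M.IsIrreducible ∧ M.IsWeightModule (sl2Cartan K)) ∧ FiniteDimensional K V := by
  obtain ⟨n, b, hb, B, hH, hE, -, hF, -, hβ⟩ := hM
  have hl : (l : K) ≠ 0 := l.ne_zero
  have hc : ∀ i : Fin (n + 1), (l : K) ^ (i : ℕ) * b ≠ 0 := fun i => mul_ne_zero (pow_ne_zero _ hl) hb
  have hH' : ∀ i, M.action (sl2H K) (B i) =
      ((l : K) ^ (i : ℕ) * b * (2 * ((i : ℕ) : K) - n)) • B i := fun i => by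
    rw [hH]
    congr 1
    ring
  refine ⟨⟨isIrreducible_of_basis B hβ hH' hc ?_ ?_, (isWeightModule_of_basis B hβ hH' hc).1⟩,
    Module.Finite.of_basis B⟩
  · intro i j hij
    have : (2 : K) * ((i : ℕ) : K) = 2 * ((j : ℕ) : K) := by linear_combination hij
    exact Fin.ext (Nat.cast_injective (mul_left_cancel₀ two_ne_zero this))
  · intro W hW
    have hiff : ∀ i, B i ∈ W ↔ B 0 ∈ W := by
      intro i
      induction i using Fin.induction with
      | zero => rfl
      | succ i ih =>
        rw [← ih]
        refine ⟨hW.mem_of_action_eq (hF i) ?_, hW.mem_of_action_eq (hE i) ?_⟩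
        · have h1 : ((i : ℕ) : K) + 1 ≠ 0 := Nat.cast_add_one_ne_zero _
          have h2 : (n : K) - (i : ℕ) ≠ 0 :=
            sub_ne_zero.2 fun h => i.2.ne' (Nat.cast_injective h)
          exact mul_ne_zero (mul_ne_zero (mul_ne_zero h1 (pow_ne_zero _ hl)) hb) h2
        · exact mul_ne_zero (pow_ne_zero _ hl) hb
    exact fun i j h => (hiff j).2 ((hiff i).1 h)

theorem IsLowestType.isIrreducible_and (hM : IsLowestType M) :
    (M.IsIrreducible ∧ M.IsWeightModule (sl2Cartan K)) ∧ ¬ FiniteDimensional K V ∧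
      (∃ v, IsLowestWeightVector M v) ∧ ¬ ∃ v, IsHighestWeightVector M v := by
  obtain ⟨τ, b, hb, hτ, B, hH, hE, hF, hF0, hβ⟩ := hM
  have hl : (l : K) ≠ 0 := l.ne_zero
  have hc : ∀ i : ℕ, (l : K) ^ i * b ≠ 0 := fun i => mul_ne_zero (pow_ne_zero _ hl) hb
  have hwt := isWeightModule_of_basis B hβ hH hc
  refine ⟨⟨isIrreducible_of_basis B hβ hH hc ?_ ?_, hwt.1⟩, fun h => ?_,
    ⟨B 0, B.ne_zero 0, hwt.2 0, hF0⟩, ?_⟩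
  · intro i j hij
    have : (2 : K) * (i : K) = 2 * (j : K) := by linear_combination hij
    exact Nat.cast_injective (mul_left_cancel₀ two_ne_zero this)
  · intro W hW
    have hiff : ∀ i, B i ∈ W ↔ B 0 ∈ W := by
      intro i
      induction i with
      | zero => rfl
      | succ i ih =>
        rw [← ih]
        refine ⟨hW.mem_of_action_eq (hF i) ?_, hW.mem_of_action_eq (hE i) (hc _)⟩
        have h1 : (i : K) + 1 ≠ 0 := Nat.cast_add_one_ne_zero _
        have h2 : τ + i ≠ 0 := fun h => hτ i (eq_neg_of_add_eq_zero_left h)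
        exact neg_ne_zero.2 (mul_ne_zero (mul_ne_zero (mul_ne_zero h1 (pow_ne_zero _ hl)) hb) h2)
    exact fun i j h => (hiff j).2 ((hiff i).1 h)
  · exact not_finite_iff_infinite.2 inferInstance (Module.Finite.finite_basis B)
  · rintro ⟨v, hv0, -, hv⟩
    have := injective_of_basis_shift B (add_left_injective 1) fun i => ⟨_, hc (i + 1), hE i⟩
    exact hv0 (this (hv.trans (map_zero _).symm))

theorem IsHighestType.isIrreducible_and (hM : IsHighestType M) :
    (M.IsIrreducible ∧ M.IsWeightModule (sl2Cartan K)) ∧ ¬ FiniteDimensional K V ∧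
      (∃ v, IsHighestWeightVector M v) ∧ ¬ ∃ v, IsLowestWeightVector M v := by
  obtain ⟨τ, b, hb, hτ, B, hH, hF, hE, hE0, hβ⟩ := hM
  have hl : (l : K) ≠ 0 := l.ne_zero
  have hc : ∀ i : ℤ, (l : K) ^ i * b ≠ 0 := fun i => mul_ne_zero (zpow_ne_zero _ hl) hb
  have hwt := isWeightModule_of_basis B hβ hH (fun i => hc _)
  refine ⟨⟨isIrreducible_of_basis B hβ hH (fun i => hc _) ?_ ?_, hwt.1⟩, fun h => ?_,
    ⟨B 0, B.ne_zero 0, hwt.2 0, hE0⟩, ?_⟩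
  · intro i j hij
    have : (2 : K) * (i : K) = 2 * (j : K) := by linear_combination -hij
    exact Nat.cast_injective (mul_left_cancel₀ two_ne_zero this)
  · intro W hW
    have hiff : ∀ i, B i ∈ W ↔ B 0 ∈ W := by
      intro i
      induction i with
      | zero => rfl
      | succ i ih =>
        rw [← ih]
        refine ⟨hW.mem_of_action_eq (hE i) ?_, hW.mem_of_action_eq (hF i) (hc _)⟩
        have h1 : (i : K) + 1 ≠ 0 := Nat.cast_add_one_ne_zero _
        exact mul_ne_zero (mul_ne_zero (mul_ne_zero h1 (zpow_ne_zero _ hl)) hb)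
          (sub_ne_zero.2 (hτ i))
    exact fun i j h => (hiff j).2 ((hiff i).1 h)
  · exact not_finite_iff_infinite.2 inferInstance (Module.Finite.finite_basis B)
  · rintro ⟨v, hv0, -, hv⟩
    have := injective_of_basis_shift B (add_left_injective 1) fun i => ⟨_, hc _, hF i⟩
    exact hv0 (this (hv.trans (map_zero _).symm))

theorem IsIntermediateType.isIrreducible_and (hM : IsIntermediateType M) :
    (M.IsIrreducible ∧ M.IsWeightModule (sl2Cartan K)) ∧ ¬ FiniteDimensional K V ∧
      (¬ ∃ v, IsLowestWeightVector M v) ∧ ¬ ∃ v, IsHighestWeightVector M v := by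
  obtain ⟨τ, μ, b, hb, hτ, B, hH, hEnn, hFnp, hEneg, hFpos, hβ⟩ := hM
  have hl : (l : K) ≠ 0 := l.ne_zero
  have hc : ∀ i : ℤ, (l : K) ^ i * b ≠ 0 := fun i => mul_ne_zero (zpow_ne_zero _ hl) hb
  have hwt := isWeightModule_of_basis B hβ hH hc
  have hE : ∀ i, ∃ a : K, a ≠ 0 ∧ M.action (sl2E K) (B i) = a • B (i + 1) := by
    intro i
    rcases lt_or_ge i 0 with hi | hi
    · refine ⟨_, ?_, hEneg i hi⟩
      rw [mul_assoc]
      refine mul_ne_zero (div_ne_zero (fun h => hτ i ?_) (by norm_num)) (hc _)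
      linear_combination -h
    · exact ⟨_, hc _, hEnn i hi⟩
  have hF : ∀ i, ∃ a : K, a ≠ 0 ∧ M.action (sl2F K) (B i) = a • B (i - 1) := by
    intro i
    rcases lt_or_ge 0 i with hi | hi
    · refine ⟨_, ?_, hFpos i hi⟩
      rw [mul_assoc]
      -- `f` from `v_i` and `e` from `v_(i-1)` are governed by the same number, that of index `i -
      -- 1`.
      refine mul_ne_zero (div_ne_zero (fun h => hτ (i - 1) ?_) (by norm_num)) (hc _)
      push_cast
      linear_combination -h
    · exact ⟨_, hc _, hFnp i hi⟩
  refine ⟨⟨isIrreducible_of_basis B hβ hH hc ?_ ?_, hwt.1⟩, fun h => ?_, ?_, ?_⟩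
  · intro i j hij
    have : (2 : K) * (i : K) = 2 * (j : K) := by linear_combination hij
    exact Int.cast_injective (mul_left_cancel₀ two_ne_zero this)
  · intro W hW
    have hup : ∀ i, B i ∈ W → B (i + 1) ∈ W := fun i hi => by
      obtain ⟨a, ha, h⟩ := hE i
      exact hW.mem_of_action_eq h ha hi
    have hdown : ∀ i, B i ∈ W → B (i - 1) ∈ W := fun i hi => by
      obtain ⟨a, ha, h⟩ := hF i
      exact hW.mem_of_action_eq h ha hi
    have hiff : ∀ i, B i ∈ W ↔ B 0 ∈ W := by
      intro i
      induction i using Int.induction_on with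
      | zero => rfl
      | succ i ih =>
        rw [← ih]
        exact ⟨fun h => by simpa using hdown _ h, hup _⟩
      | pred i ih =>
        rw [← ih]
        exact ⟨fun h => by simpa using hup _ h, hdown _⟩
    exact fun i j h => (hiff j).2 ((hiff i).1 h)
  · exact not_finite_iff_infinite.2 inferInstance (Module.Finite.finite_basis B)
  · rintro ⟨v, hv0, -, hv⟩
    have := injective_of_basis_shift B (sub_left_injective (b := (1 : ℤ))) hF
    exact hv0 (this (hv.trans (map_zero _).symm))
  · rintro ⟨v, hv0, -, hv⟩
    have := injective_of_basis_shift B (add_left_injective (1 : ℤ)) hE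
    exact hv0 (this (hv.trans (map_zero _).symm))

end Types

/-! ### Modules with the prescribed formulas -/

section Existence

variable {K : Type*} [Field K]

theorem sl2Relations_of_lowest_family {V : Type*} [AddCommGroup V] [Module K V] (l : Kˣ) {τ b : K}
    {v : ℕ → V} (hv : Submodule.span K (Set.range v) = ⊤) {β E F H : Module.End K V}
    (hβ : ∀ i, β (v i) = ((l : K) ^ i * b) • v i)
    (hE : ∀ i, E (v i) = ((l : K) ^ (i + 1) * b) • v (i + 1))
    (hF : ∀ i : ℕ, F (v (i + 1)) = (-(((i : K) + 1) * (l : K) ^ i * b * (τ + i))) • v i)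
    (hF0 : F (v 0) = 0)
    (hH : ∀ i, H (v i) = ((l : K) ^ i * b * (τ + 2 * i)) • v i) :
    HomRep.Sl2Relations l β E F H := by
  have hl : (l : K) ≠ 0 := l.ne_zero
  refine .of_span hv (fun i => ?_) (fun i => ?_) (fun i => ?_) (fun i => ?_) (fun i => ?_)
    fun i => ?_
  · simp only [hE, hβ, map_smul, smul_smul]
    congr 1
    ring
  · cases i with
    | zero => simp [hF0, hβ]
    | succ i =>
      simp only [hF, hβ, map_smul, smul_smul]
      congr 1
      field_simp
      ring
  · simp only [hH, hβ, map_smul, smul_smul]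
    congr 1
    ring
  · cases i with
    | zero =>
      simp only [hF0, hF, hE, hH, hβ, map_smul, smul_smul, map_zero, ← neg_smul, smul_zero,
        zero_sub]
      congr 1
      field_simp
      push_cast
      ring
    | succ i =>
      simp only [hF, hE, hH, hβ, map_smul, smul_smul, ← sub_smul]
      congr 1
      field_simp
      push_cast
      ring
  · simp only [hH, hE, hβ, map_smul, smul_smul, ← sub_smul]
    congr 1
    push_cast
    ring
  · cases i with
    | zero => simp [hF0, hH, hβ]
    | succ i =>
      simp only [hF, hH, hβ, map_smul, smul_smul, ← sub_smul]
      congr 1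
      field_simp
      push_cast
      ring

/-- The lowest weight formulas for `τ = -n`, truncated by setting `v_k = 0` for `k > n`: there `f`
sends `v_(n+1)` to zero, so the truncation is consistent. -/
theorem exists_hasFiniteForm (l : Kˣ) (n : ℕ) (b : K) :
    ∃ M : HomRep (homSl2 l) (Fin (n + 1) →₀ K), HasFiniteForm M n b := by
  set B : Module.Basis (Fin (n + 1)) K (Fin (n + 1) →₀ K) := Finsupp.basisSingleOne with hB
  set v : ℕ → Fin (n + 1) →₀ K := fun k => if h : k < n + 1 then B ⟨k, h⟩ else 0 with hvdef
  have hvB : ∀ i : Fin (n + 1), v i = B i := fun i => dif_pos i.2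
  have hv0 : ∀ k, n + 1 ≤ k → v k = 0 := fun k hk => dif_neg (not_lt.2 hk)
  have ext : ∀ (g : Fin (n + 1) → Fin (n + 1) →₀ K) (w : ℕ → Fin (n + 1) →₀ K),
      (∀ i : Fin (n + 1), g i = w i) → (∀ k, n + 1 ≤ k → w k = 0) →
      ∀ k, B.constr K g (v k) = w k := by
    intro g w hgw hw k
    rcases lt_or_ge k (n + 1) with hk | hk
    · have := hvB ⟨k, hk⟩
      simp only at this
      rw [this, B.constr_basis, hgw]
    · rw [hv0 k hk, map_zero, hw k hk]
  have hspan : Submodule.span K (Set.range v) = ⊤ := by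
    rw [eq_top_iff, ← B.span_eq]
    refine Submodule.span_mono ?_
    rintro _ ⟨i, rfl⟩
    exact ⟨i, hvB i⟩
  have hβ := ext (fun i => ((l : K) ^ (i : ℕ) * b) • v i) (fun i => ((l : K) ^ i * b) • v i)
    (fun i => rfl) fun k hk => by rw [hv0 k hk, smul_zero]
  have hH := ext (fun i => ((l : K) ^ (i : ℕ) * b * (-n + 2 * (i : ℕ))) • v i)
    (fun i => ((l : K) ^ i * b * (-n + 2 * i)) • v i)
    (fun i => rfl) fun k hk => by rw [hv0 k hk, smul_zero]
  have hE := ext (fun i => ((l : K) ^ ((i : ℕ) + 1) * b) • v (i + 1))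
    (fun i => ((l : K) ^ (i + 1) * b) • v (i + 1))
    (fun i => rfl) fun k hk => by rw [hv0 (k + 1) (by omega), smul_zero]
  set w : ℕ → Fin (n + 1) →₀ K := fun k => Nat.casesOn k 0
    fun i => (-(((i : K) + 1) * (l : K) ^ i * b * (-n + i))) • v i with hw
  have hF := ext (fun i => w i) w (fun i => rfl) fun k hk => by
    obtain ⟨k, rfl⟩ : ∃ j, k = j + 1 := ⟨k - 1, by omega⟩
    -- At index `n + 1` the vector `v_n` is not zero; it is the factor `-n + n` that vanishes.
    rcases eq_or_lt_of_le hk with h | h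
    · have : n = k := by omega
      subst this
      simp [hw]
    · simp [hw, hv0 k (by omega)]
  have R := sl2Relations_of_lowest_family l hspan hβ hE (fun i => hF (i + 1)) (hF 0) hH
  refine ⟨HomRep.ofSl2 _ _ _ _ R, B, fun i => ?_, fun i => ?_, ?_, fun i => ?_, ?_, fun i => ?_⟩
  · rw [HomRep.ofSl2_h, ← hvB, hH]
    congr 1
    ring
  · rw [HomRep.ofSl2_e, ← hvB, ← hvB, hE]
    rfl
  · rw [HomRep.ofSl2_e, ← hvB, hE, Fin.val_last, hv0 _ le_rfl, smul_zero]
  · rw [HomRep.ofSl2_f, ← hvB, ← hvB, hF]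
    change (-((((i : ℕ) : K) + 1) * (l : K) ^ (i : ℕ) * b * (-n + (i : ℕ)))) • v i = _ • v i
    congr 1
    ring
  · rw [HomRep.ofSl2_f, ← hvB, hF]
    rfl
  · rw [← hvB]
    exact hβ i

/-- The action of `e`, `f`, `h`, `β` on a lowest weight module with basis indexed by `ℕ`. -/
theorem exists_lowest_relations (l : Kˣ) (τ b : K) :
    ∃ β E F H : Module.End K (ℕ →₀ K), HomRep.Sl2Relations l β E F H ∧
      ∃ B : Module.Basis ℕ K (ℕ →₀ K),
      (∀ i, H (B i) = ((l : K) ^ i * b * (τ + 2 * i)) • B i) ∧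
      (∀ i, E (B i) = ((l : K) ^ (i + 1) * b) • B (i + 1)) ∧
      (∀ i : ℕ, F (B (i + 1)) = (-(((i : K) + 1) * (l : K) ^ i * b * (τ + i))) • B i) ∧
      F (B 0) = 0 ∧ ∀ i, β (B i) = ((l : K) ^ i * b) • B i := by
  set B : Module.Basis ℕ K (ℕ →₀ K) := Finsupp.basisSingleOne with hB
  obtain ⟨H, hH⟩ : ∃ H : Module.End K _, ∀ i, H (B i) = ((l : K) ^ i * b * (τ + 2 * i)) • B i :=
    ⟨B.constr K _, B.constr_basis K _⟩
  obtain ⟨E, hE⟩ : ∃ E : Module.End K _, ∀ i, E (B i) = ((l : K) ^ (i + 1) * b) • B (i + 1) :=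
    ⟨B.constr K _, B.constr_basis K _⟩
  obtain ⟨β, hβ⟩ : ∃ β : Module.End K _, ∀ i, β (B i) = ((l : K) ^ i * b) • B i :=
    ⟨B.constr K _, B.constr_basis K _⟩
  obtain ⟨F, hF⟩ : ∃ F : Module.End K (ℕ →₀ K), ∀ k : ℕ, F (B k) = Nat.casesOn k 0
      fun i => (-(((i : K) + 1) * (l : K) ^ i * b * (τ + i))) • B i :=
    ⟨B.constr K _, B.constr_basis K _⟩
  exact ⟨_, _, _, _, sl2Relations_of_lowest_family l B.span_eq hβ hE (fun i => hF (i + 1)) (hF 0) hH,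
    B, hH, hE, fun i => hF (i + 1), hF 0, hβ⟩

theorem exists_hasLowestForm (l : Kˣ) (τ b : K) :
    ∃ M : HomRep (homSl2 l) (ℕ →₀ K), HasLowestForm M τ b := by
  obtain ⟨β, E, F, H, R, B, hH, hE, hF, hF0, hβ⟩ := exists_lowest_relations l τ b
  refine ⟨HomRep.ofSl2 _ _ _ _ R, B, ?_, ?_, ?_, ?_, hβ⟩
  · rwa [HomRep.ofSl2_h]
  · rwa [HomRep.ofSl2_e]
  · rwa [HomRep.ofSl2_f]
  · rwa [HomRep.ofSl2_f]

theorem exists_hasHighestForm (l : Kˣ) (τ b : K) :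
    ∃ M : HomRep (homSl2 l) (ℕ →₀ K), HasHighestForm M τ b := by
  -- The dual of a lowest weight module of weight `-τ` for the inverse twist.
  obtain ⟨β, E, F, H, R, B, hH, hE, hF, hF0, hβ⟩ := exists_lowest_relations l⁻¹ (-τ) b
  refine ⟨HomRep.ofSl2 _ _ _ _ R.dual, B, fun i => ?_, fun i => ?_, fun i => ?_, ?_, fun i => ?_⟩
  · rw [HomRep.ofSl2_h, LinearMap.neg_apply, hH, ← neg_smul]
    congr 1
    simp
    ring
  · rw [HomRep.ofSl2_f, hE]
    congr 1
    rw [show (-(i : ℤ) - 1) = -((i + 1 : ℕ) : ℤ) by push_cast; ring, zpow_neg, zpow_natCast]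
    simp
  · rw [HomRep.ofSl2_e, hF]
    congr 1
    simp
    ring
  · rwa [HomRep.ofSl2_e]
  · refine (hβ i).trans ?_
    congr 1
    simp

theorem exists_hasIntermediateForm [CharZero K] (l : Kˣ) (τ μ b : K) :
    ∃ M : HomRep (homSl2 l) (ℤ →₀ K), HasIntermediateForm M τ μ b := by
  have hl : (l : K) ≠ 0 := l.ne_zero
  set B : Module.Basis ℤ K (ℤ →₀ K) := Finsupp.basisSingleOne with hB
  obtain ⟨p, hp⟩ : ∃ p : ℤ → K, p = fun i : ℤ =>
    if 0 ≤ i then 1 else (μ - (τ + 2 * i + 1) ^ 2 + 1) / 4 := ⟨_, rfl⟩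
  obtain ⟨q, hq⟩ : ∃ q : ℤ → K, q = fun i : ℤ =>
    if i ≤ 0 then 1 else (μ - (τ + 2 * i - 1) ^ 2 + 1) / 4 := ⟨_, rfl⟩
  -- Between `v_(i-1)` and `v_i` one of `e`, `f` has normalized coefficient `1` and the other the
  -- Casimir expression, so the product is given by one formula for all `i`.
  have hpq : ∀ i : ℤ, p (i - 1) * q i = (μ - (τ + 2 * i - 1) ^ 2 + 1) / 4 := by
    intro i
    rcases lt_or_ge 0 i with hi | hi
    · simp [hp, hq, not_le.2 hi, show (1 : ℤ) ≤ i from hi]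
    · simp only [hp, hq, if_pos hi, if_neg (show ¬ (0 : ℤ) ≤ i - 1 by omega)]
      push_cast
      ring
  have hqp : ∀ i : ℤ, q (i + 1) * p i = (μ - (τ + 2 * i + 1) ^ 2 + 1) / 4 := by
    intro i
    have := hpq (i + 1)
    rw [add_sub_cancel_right] at this
    rw [mul_comm, this]
    push_cast
    ring
  obtain ⟨H, hH⟩ : ∃ H : Module.End K _, ∀ i, H (B i) = ((l : K) ^ i * b * (τ + 2 * i)) • B i :=
    ⟨B.constr K _, B.constr_basis K _⟩
  obtain ⟨E, hE⟩ : ∃ E : Module.End K _, ∀ i, E (B i) = (p i * ((l : K) ^ (i + 1) * b)) • B (i + 1) :=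
    ⟨B.constr K _, B.constr_basis K _⟩
  obtain ⟨F, hF⟩ : ∃ F : Module.End K _, ∀ i, F (B i) = (q i * ((l : K) ^ (i - 1) * b)) • B (i - 1) :=
    ⟨B.constr K _, B.constr_basis K _⟩
  obtain ⟨β, hβ⟩ : ∃ β : Module.End K _, ∀ i, β (B i) = ((l : K) ^ i * b) • B i :=
    ⟨B.constr K _, B.constr_basis K _⟩
  have hs : ∀ i : ℤ, (l : K) ^ (i + 1) = l ^ i * l := fun i => zpow_add_one₀ hl i
  have hs' : ∀ i : ℤ, (l : K) ^ (i - 1) = l ^ i * (l : K)⁻¹ := fun i => zpow_sub_one₀ hl i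
  have R : HomRep.Sl2Relations l β E F H := .of_span B.span_eq (fun i => by
      simp only [hE, hβ, map_smul, smul_smul, hs]
      congr 1
      ring) (fun i => by
      simp only [hF, hβ, map_smul, smul_smul, hs']
      congr 1
      ring) (fun i => by
      simp only [hH, hβ, map_smul, smul_smul]
      congr 1
      ring) (fun i => by
      simp only [hF, hE, hH, hβ, map_smul, smul_smul, add_sub_cancel_right, sub_add_cancel,
        ← sub_smul, hs, hs']
      congr 1
      have h1 := hpq i
      have h2 := hqp i
      field_simp
      -- `[e, f] = h` amounts to `(τ+2i+1)² - (τ+2i-1)² = 4 (τ+2i)`.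
      linear_combination b ^ 2 * h2 - b ^ 2 * h1) (fun i => by
      simp only [hE, hH, hβ, map_smul, smul_smul, ← sub_smul, hs]
      congr 1
      push_cast
      ring) (fun i => by
      simp only [hF, hH, hβ, map_smul, smul_smul, ← sub_smul, hs']
      congr 1
      push_cast
      ring)
  refine ⟨HomRep.ofSl2 _ _ _ _ R, B, fun i => ?_, fun i hi => ?_, fun i hi => ?_, fun i hi => ?_,
    fun i hi => ?_, hβ⟩
  · rw [HomRep.ofSl2_h, hH]
  · rw [HomRep.ofSl2_e, hE]
    simp [hp, hi]
  · rw [HomRep.ofSl2_f, hF]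
    simp [hq, hi]
  · rw [HomRep.ofSl2_e, hE, hp]
    simp only [if_neg (not_le.2 hi)]
    congr 1
    ring
  · rw [HomRep.ofSl2_f, hF, hq]
    simp only [if_neg (not_le.2 hi)]
    congr 1
    ring

end Existence

end HomLie

/-! ### The classification theorem -/

theorem mainTheorem3 {K : Type*} [Field K] [IsAlgClosed K] [CharZero K] (l : Kˣ) :
    -- the irreducible weight modules are exactly the modules of the four types
    (∀ (V : Type*) [AddCommGroup V] [Module K V] (M : HomLie.HomRep (HomLie.homSl2 l) V),
      (M.IsIrreducible ∧ M.IsWeightModule (HomLie.sl2Cartan K)) ↔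
        (HomLie.IsFiniteType M ∨ HomLie.IsLowestType M ∨ HomLie.IsHighestType M ∨
          HomLie.IsIntermediateType M)) ∧
    -- no module has two of the types
    (∀ (V : Type*) [AddCommGroup V] [Module K V] (M : HomLie.HomRep (HomLie.homSl2 l) V),
      ¬(HomLie.IsFiniteType M ∧ HomLie.IsLowestType M) ∧
      ¬(HomLie.IsFiniteType M ∧ HomLie.IsHighestType M) ∧
      ¬(HomLie.IsFiniteType M ∧ HomLie.IsIntermediateType M) ∧
      ¬(HomLie.IsLowestType M ∧ HomLie.IsHighestType M) ∧
      ¬(HomLie.IsLowestType M ∧ HomLie.IsIntermediateType M) ∧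
      ¬(HomLie.IsHighestType M ∧ HomLie.IsIntermediateType M)) ∧
    -- the types are what their names say
    (∀ (V : Type*) [AddCommGroup V] [Module K V] (M : HomLie.HomRep (HomLie.homSl2 l) V),
      M.IsIrreducible → M.IsWeightModule (HomLie.sl2Cartan K) →
      (HomLie.IsFiniteType M ↔ FiniteDimensional K V) ∧
      (HomLie.IsLowestType M ↔
        ¬ FiniteDimensional K V ∧ ∃ v, HomLie.IsLowestWeightVector M v) ∧
      (HomLie.IsHighestType M ↔
        ¬ FiniteDimensional K V ∧ ∃ v, HomLie.IsHighestWeightVector M v) ∧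
      (HomLie.IsIntermediateType M ↔
        ¬ FiniteDimensional K V ∧ (¬ ∃ v, HomLie.IsLowestWeightVector M v) ∧
          ¬ ∃ v, HomLie.IsHighestWeightVector M v)) ∧
    -- for all admissible parameters the formulas do define a module
    (∀ (n : ℕ) (b : K), b ≠ 0 →
      ∃ M : HomLie.HomRep (HomLie.homSl2 l) (Fin (n + 1) →₀ K), HomLie.HasFiniteForm M n b) ∧
    (∀ τ b : K, b ≠ 0 → (∀ m : ℕ, τ ≠ -m) →
      ∃ M : HomLie.HomRep (HomLie.homSl2 l) (ℕ →₀ K), HomLie.HasLowestForm M τ b) ∧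
    (∀ τ b : K, b ≠ 0 → (∀ m : ℕ, τ ≠ m) →
      ∃ M : HomLie.HomRep (HomLie.homSl2 l) (ℕ →₀ K), HomLie.HasHighestForm M τ b) ∧
    (∀ τ μ b : K, b ≠ 0 → (∀ i : ℤ, (τ + 2 * i + 1) ^ 2 ≠ μ + 1) →
      ∃ M : HomLie.HomRep (HomLie.homSl2 l) (ℤ →₀ K),
        HomLie.HasIntermediateForm M τ μ b) := by
  refine ⟨fun V _ _ M => ⟨fun h => HomLie.isType_of_isIrreducible h.1 h.2, ?_⟩,
    fun V _ _ M => ⟨?_, ?_, ?_, ?_, ?_, ?_⟩, fun V _ _ M hI hW => ?_,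
    fun n b _ => HomLie.exists_hasFiniteForm l n b,
    fun τ b _ _ => HomLie.exists_hasLowestForm l τ b,
    fun τ b _ _ => HomLie.exists_hasHighestForm l τ b,
    fun τ μ b _ _ => HomLie.exists_hasIntermediateForm l τ μ b⟩
  · rintro (h | h | h | h)
    exacts [h.isIrreducible_and.1, h.isIrreducible_and.1, h.isIrreducible_and.1,
      h.isIrreducible_and.1]
  · exact fun h => h.2.isIrreducible_and.2.1 h.1.isIrreducible_and.2
  · exact fun h => h.2.isIrreducible_and.2.1 h.1.isIrreducible_and.2
  · exact fun h => h.2.isIrreducible_and.2.1 h.1.isIrreducible_and.2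
  · exact fun h => h.2.isIrreducible_and.2.2.2 h.1.isIrreducible_and.2.2.1
  · exact fun h => h.2.isIrreducible_and.2.2.1 h.1.isIrreducible_and.2.2.1
  · exact fun h => h.2.isIrreducible_and.2.2.2 h.1.isIrreducible_and.2.2.1
  -- The four types imply mutually exclusive properties, and one of the types always occurs; so each
  -- property also implies its type.
  · have h1 : HomLie.IsFiniteType M → FiniteDimensional K V := fun h => h.isIrreducible_and.2
    have h2 := fun h : HomLie.IsLowestType M => h.isIrreducible_and.2
    have h3 := fun h : HomLie.IsHighestType M => h.isIrreducible_and.2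
    have h4 := fun h : HomLie.IsIntermediateType M => h.isIrreducible_and.2
    have h := HomLie.isType_of_isIrreducible hI hW
    tauto
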